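/- **Setting.** Let $n,t$ be natural numbers with $t\le n-2$. There are agents $1,\dots,n$ that operate in synchronous rounds. Each agent $i$ has an initial preference $\mathit{init}_i\in\{0,1\}$ and in each round performs one of the actions $\mathtt{decide}_i(0)$, $\mathtt{decide}_i(1)$, $\mathtt{noop}$; an action protocol $P=(P_1,\dots,P_n)$ maps each local state of agent $i$ to an action. A failure pattern is a pair $(\mathcal N,F)$ with $\mathcal N$ the set of nonfaulty agents and $F(m,i,j)\in\{0,1\}$ saying whether the message from $i$ to $j$ (possibly $j=i$) in round $m+1$ is delivered; if not, $j$ receives $\bot$ (no message). In the sending-omissions model $SO(t)$ at most $t$ agents are faulty, and $F(m,i,j)=0$ only if $i\notin\mathcal N$. *Context $\gamma_{\min,n,t}$* (failure model $SO(t)$). Local states are $\langle \mathit{time}_i,\mathit{init}_i,\mathit{decided}_i,\mathit{rd}_i\rangle$ with $\mathit{decided}_i,\mathit{rd}_i\in\{0,1,\bot\}$, initially $\langle 0,\mathit{init}_i,\bot,\bot\rangle$. An agent performing $\mathtt{decide}_i(v)$ sends $v$ to every agent; otherwise it sends nothing. In each round $\mathit{time}_i$ increases by $1$, $\mathit{init}_i$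 is unchanged, $\mathit{decided}_i$ is set to $v$ if $i$ performs $\mathtt{decide}_i(v)$ and is otherwise unchanged, and $\mathit{rd}_i$ is set to $0$ if $i$ receives a message $0$ in the round, else to $1$ if it receives a message $1$, else to $\bot$. *Context $\gamma_{\mathit{basic},n,t}$* (failure model $SO(t)$). As before, with an additional message $(\mathit{init},1)$, which agent $i$ sends to every agent when it performs $\mathtt{noop}$ in a state with $\mathit{init}_i=1$ and $\mathit{decided}_i=\mathit{rd}_i=\bot$, and an additional state component $\#1_i\in\{0,\dots,n\}$, initially $0$. In each round $\#1_i$ is set to the number of messages $(\mathit{init},1)$ that $i$ receives in the round if (after the round's action) $\mathit{decided}_i=\bot$ and $i$ receives no message $0$ or $1$ in the round; otherwise it is set to $0$. A context $\gamma$, an action protocol $P$, a failure pattern of $\gamma$ and initial local states determine a run $r$, where $r_i(m)$ is the local state of agent $i$ at time $m$. Runs of two action protocols *correspond* if they have the same failure pattern and the same initial local states. *EBA decision protocol.* $P$ is an EBA decision protocol for $\gamma$ if in every run of $P$ in $\gamma$: * (Single decision) every agent performs $\mathtt{noop}$ whenever its $\mathit{decided}_i\neq\bot$; * (Unique Decision)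 if $\mathit{decided}_i=v$ at some time, then $\mathit{decided}_i\ne 1-v$ at all later times; * (Agreement) there are no nonfaulty $i,j$ with $\mathit{decided}_i=v$, $\mathit{decided}_j=v'$ and $v\neq v'$; * (Validity) if $i$ is nonfaulty and $\mathit{decided}_i=v$, then $\mathit{init}_j=v$ for some agent $j$; * (Termination) every nonfaulty agent $i$ eventually has $\mathit{decided}_i\ne\bot$. *Optimality.* $P$ *dominates* $P'$ with respect to $\gamma$ if for all corresponding runs $r$ of $P$ and $r'$ of $P'$, every nonfaulty agent $i$ and all times $m'<m$: if $P_i(r_i(m))$ is a decide action, then $P'_i(r'_i(m'))$ is not a decide action. $P$ *strictly dominates* $P'$ if $P$ dominates $P'$ and $P'$ does not dominate $P$. $P$ is an *optimal EBA decision protocol with respect to $\gamma$* if it is an EBA decision protocol for $\gamma$ and no EBA decision protocol for $\gamma$ strictly dominates it. *The protocols.* Both protocols perform $\mathtt{noop}$ if $\mathit{decided}_i\ne\bot$; else $\mathtt{decide}_i(0)$ if $\mathit{init}_i=0$ or $\mathit{rd}_i=0$; else $\mathtt{decide}_i(1)$ if condition $(*)$ holds; else $\mathtt{noop}$. Condition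 $(*)$ is $\mathit{time}_i=t+1$ for $P^{\min}$, and ($\#1_i>n-\mathit{time}_i$ or $\mathit{rd}_i=1$) for $P^{\mathit{basic}}$. **Statement.** $P^{\mathit{basic}}$ is an optimal EBA decision protocol with respect to $\gamma_{\mathit{basic},n,t}$, and $P^{\min}$ is an optimal EBA decision protocol with respect to $\gamma_{\min,n,t}$. -/

import Mathlib

/-! # Eventual Byzantine agreement with limited information exchange -/

namespace EBA

/-- Decision values and initial preferences are `0` and `1`. -/
abbrev Val := Fin 2

/-- The actions of an agent: `decide v` or do nothing. -/
inductive Action where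
  | decide (v : Val)
  | noop

/-- An information-exchange protocol for `n` agents. An element of `Option (M i)` is either a message
of agent `i` or `none`, which stands for "no message" (`⊥`).
* `I i` is the set of initial states of agent `i`;
* `μ i s a j` is the message that `i` sends to `j` when performing `a` in state `s`;
* `δ i s a ρ` is the new state of `i` when it performed `a` in state `s` and received `ρ j`
  from each agent `j`. -/
structure InfoExchange (n : ℕ) where
  L : Fin n → Type
  I : ∀ i, Set (L i)
  M : Fin n → Type
  μ : ∀ i, L i → Action → Fin n → Option (M i)
  δ : ∀ i, L i → Action → (∀ j, Option (M j)) → L i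

/-- A failure pattern (adversary): the set `N` of nonfaulty agents, and for each `m`, `i`, `j`
whether the message from `i` to `j` in round `m + 1` is delivered. -/
structure FailurePattern (n : ℕ) where
  N : Finset (Fin n)
  F : ℕ → Fin n → Fin n → Bool

/-- The sending-omissions failure model: at most `t` faulty agents, and only messages sent by
faulty agents may be lost. -/
def SO (n t : ℕ) : Set (FailurePattern n) :=
  {α | (α.N)ᶜ.card ≤ t ∧ ∀ m i j, α.F m i j = false → i ∉ α.N}

/-- A global state: the environment state (a failure pattern) and the local states. -/
structure GlobalState {n : ℕ} (E : InfoExchange n) where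
  env : FailurePattern n
  loc : ∀ i, E.L i

/-- An action protocol: for each agent, a map from its local states to actions. -/
abbrev ActionProtocol {n : ℕ} (E : InfoExchange n) := ∀ i, E.L i → Action

/-- The message that `j` receives from `i` in round `k + 1` starting from global state `g`. -/
def delivered {n : ℕ} {E : InfoExchange n} (P : ActionProtocol E) (k : ℕ) (g : GlobalState E)
    (i j : Fin n) : Option (E.M i) :=
  if g.env.F k i j then E.μ i (g.loc i) (P i (g.loc i)) j else none

/-- The global state at time `k + 1` determined by the global state `g` at time `k`. -/
def step {n : ℕ} {E : InfoExchange n} (P : ActionProtocol E) (k : ℕ) (g : GlobalState E) :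
    GlobalState E where
  env := g.env
  loc := fun i => E.δ i (g.loc i) (P i (g.loc i)) (fun j => delivered P k g j i)

/-- A run assigns a global state to each time. -/
abbrev Run {n : ℕ} (E : InfoExchange n) := ℕ → GlobalState E

/-- The system of all runs generated by `E`, a failure model and an action protocol. -/
def system {n : ℕ} (E : InfoExchange n) (failures : Set (FailurePattern n))
    (P : ActionProtocol E) : Set (Run E) :=
  {r | (r 0).env ∈ failures ∧ (∀ i, (r 0).loc i ∈ E.I i) ∧ ∀ k, r (k + 1) = step P k (r k)}

/-- An EBA context: an information-exchange protocol and a failure model, where each local state has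
components `time`, `init`, `decided` and `rd` (`none` is `⊥`), which behave as prescribed. The
functions `time`, `init`, `decided`, `rd` and the set of nonfaulty agents of the failure pattern
interpret the basic propositions. -/
structure EBAContext (n : ℕ) where
  E : InfoExchange n
  failures : Set (FailurePattern n)
  time : ∀ i, E.L i → ℕ
  init : ∀ i, E.L i → Val
  decided : ∀ i, E.L i → Option Val
  rd : ∀ i, E.L i → Option Val
  time_initial : ∀ i, ∀ s ∈ E.I i, time i s = 0
  decided_initial : ∀ i, ∀ s ∈ E.I i, decided i s = none
  rd_initial : ∀ i, ∀ s ∈ E.I i, rd i s = none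
  /-- Messages announcing a decision on `v`. -/
  Mdec : ∀ i, Val → Set (Option (E.M i))
  /-- The remaining messages. -/
  Moth : ∀ i, Set (Option (E.M i))
  disjoint_dec : ∀ i, Disjoint (Mdec i 0) (Mdec i 1)
  disjoint_oth : ∀ i v, Disjoint (Mdec i v) (Moth i)
  none_notMem : ∀ i v, none ∉ Mdec i v
  send_decide : ∀ i s v j, E.μ i s (.decide v) j ∈ Mdec i v
  send_noop : ∀ i s j, E.μ i s .noop j ∈ Moth i
  time_δ : ∀ i s a ρ, time i (E.δ i s a ρ) = time i s + 1
  init_δ : ∀ i s a ρ, init i (E.δ i s a ρ) = init i s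
  decided_decide : ∀ i s v ρ, decided i (E.δ i s (.decide v) ρ) = some v
  decided_noop : ∀ i s ρ, decided i (E.δ i s .noop ρ) = decided i s
  rd_zero : ∀ i s a ρ, (∃ j, ρ j ∈ Mdec j 0) → rd i (E.δ i s a ρ) = some 0
  rd_one : ∀ i s a ρ, (¬ ∃ j, ρ j ∈ Mdec j 0) → (∃ j, ρ j ∈ Mdec j 1) →
    rd i (E.δ i s a ρ) = some 1
  rd_none : ∀ i s a ρ, (¬ ∃ v j, ρ j ∈ Mdec j v) → rd i (E.δ i s a ρ) = none

variable {n : ℕ}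

/-- The runs of the action protocol `P` in the context `γ`. -/
def EBAContext.runs (γ : EBAContext n) (P : ActionProtocol γ.E) : Set (Run γ.E) :=
  system γ.E γ.failures P

/-- No agent decides again after it has decided. -/
def DecidesOnce (γ : EBAContext n) (P : ActionProtocol γ.E) : Prop :=
  ∀ r ∈ γ.runs P, ∀ m i, γ.decided i ((r m).loc i) ≠ none → P i ((r m).loc i) = .noop

/-- `decided_i = v` excludes `decided_i = 1 - v` at all later times. -/
def UniqueDecision (γ : EBAContext n) (P : ActionProtocol γ.E) : Prop :=
  ∀ r ∈ γ.runs P, ∀ m i v, γ.decided i ((r m).loc i) = some v →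
    ∀ m' ≥ m, γ.decided i ((r m').loc i) ≠ some (1 - v)

/-- Nonfaulty agents do not decide on different values. -/
def Agreement (γ : EBAContext n) (P : ActionProtocol γ.E) : Prop :=
  ∀ r ∈ γ.runs P, ∀ m i j v v', v ≠ v' →
    ¬ (i ∈ (r m).env.N ∧ j ∈ (r m).env.N ∧
      γ.decided i ((r m).loc i) = some v ∧ γ.decided j ((r m).loc j) = some v')

/-- A nonfaulty agent decides only on the initial preference of some agent. -/
def Validity (γ : EBAContext n) (P : ActionProtocol γ.E) : Prop :=
  ∀ r ∈ γ.runs P, ∀ m i v, γ.decided i ((r m).loc i) = some v → i ∈ (r m).env.N →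
    ∃ j, γ.init j ((r m).loc j) = v

/-- Every nonfaulty agent eventually decides. -/
def Termination (γ : EBAContext n) (P : ActionProtocol γ.E) : Prop :=
  ∀ r ∈ γ.runs P, ∀ m i, i ∈ (r m).env.N → ∃ m' ≥ m, γ.decided i ((r m').loc i) ≠ none

/-- `P` is an EBA decision protocol for the context `γ`. -/
structure IsEBADecisionProtocol (γ : EBAContext n) (P : ActionProtocol γ.E) : Prop where
  decidesOnce : DecidesOnce γ P
  uniqueDecision : UniqueDecision γ P
  agreement : Agreement γ P
  validity : Validity γ P
  termination : Termination γ P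

/-- `P` dominates `P'`: in corresponding runs (equal initial global states), no nonfaulty agent
decides with `P` later than it decides with `P'`. -/
def Dominates (γ : EBAContext n) (P P' : ActionProtocol γ.E) : Prop :=
  ∀ r ∈ γ.runs P, ∀ r' ∈ γ.runs P', r 0 = r' 0 →
    ∀ i ∈ (r 0).env.N, ∀ m v, P i ((r m).loc i) = .decide v →
      ∀ m' < m, ∀ w, P' i ((r' m').loc i) ≠ .decide w

/-- `P` strictly dominates `P'`. -/
def StrictlyDominates (γ : EBAContext n) (P P' : ActionProtocol γ.E) : Prop :=
  Dominates γ P P' ∧ ¬ Dominates γ P' P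

/-- `P` is an optimal EBA decision protocol with respect to `γ`. -/
def IsOptimalEBA (γ : EBAContext n) (P : ActionProtocol γ.E) : Prop :=
  IsEBADecisionProtocol γ P ∧
    ∀ P' : ActionProtocol γ.E, IsEBADecisionProtocol γ P' → ¬ StrictlyDominates γ P' P

/-! ### Updates shared by the two contexts -/

/-- The new value of `decided`. -/
def newDecided (d : Option Val) : Action → Option Val
  | .decide v => some v
  | .noop => d

/-- The new value of `rd`, given the decision announced by each agent's message (if any). -/
def newRd (ρ : Fin n → Option Val) : Option Val :=
  if ∃ j, ρ j = some 0 then some 0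
  else if ∃ j, ρ j = some 1 then some 1
  else none

/-! ### The minimal context and protocol -/

/-- Local states `⟨time, init, decided, rd⟩`. -/
structure MinState where
  time : ℕ
  init : Val
  decided : Option Val
  rd : Option Val

/-- The minimal information-exchange protocol: the only messages are `0` and `1`. -/
abbrev minExchange (n : ℕ) : InfoExchange n where
  L := fun _ => MinState
  I := fun _ => {s | ∃ v, s = ⟨0, v, none, none⟩}
  M := fun _ => Val
  μ := fun _ _ a _ => match a with
    | .decide v => some v
    | .noop => none
  δ := fun _ s a ρ => ⟨s.time + 1, s.init, newDecided s.decided a, newRd ρ⟩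

/-- The minimal context with `n` agents, at most `t` of them faulty. -/
abbrev minContext (n t : ℕ) : EBAContext n where
  E := minExchange n
  failures := SO n t
  time := fun _ s => MinState.time s
  init := fun _ s => MinState.init s
  decided := fun _ s => MinState.decided s
  rd := fun _ s => MinState.rd s
  time_initial := by rintro i s ⟨v, rfl⟩; rfl
  decided_initial := by rintro i s ⟨v, rfl⟩; rfl
  rd_initial := by rintro i s ⟨v, rfl⟩; rfl
  Mdec := fun _ v => {some v}
  Moth := fun _ => {none}
  disjoint_dec := fun _ => Set.disjoint_singleton.2
    fun h => absurd (Option.some.inj h) (by decide)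
  disjoint_oth := fun _ v => Set.disjoint_singleton.2 fun h => by cases h
  none_notMem := fun _ v h => by cases h
  send_decide := fun _ _ _ _ => rfl
  send_noop := fun _ _ _ => rfl
  time_δ := fun _ _ _ _ => rfl
  init_δ := fun _ _ _ _ => rfl
  decided_decide := fun _ _ _ _ => rfl
  decided_noop := fun _ _ _ => rfl
  rd_zero := fun _ _ _ _ h => if_pos h
  rd_one := fun _ _ _ _ h0 h1 => (if_neg h0).trans (if_pos h1)
  rd_none := fun _ _ _ _ h =>
    (if_neg fun ⟨j, hj⟩ => h ⟨0, j, hj⟩).trans (if_neg fun ⟨j, hj⟩ => h ⟨1, j, hj⟩)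

/-- The protocol `P^min`. -/
def Pmin (n t : ℕ) : ActionProtocol (minContext n t).E := fun _ (s : MinState) =>
  if s.decided ≠ none then .noop
  else if s.init = 0 ∨ s.rd = some 0 then .decide 0
  else if s.time = t + 1 then .decide 1
  else .noop

/-! ### The basic context and protocol -/

/-- Local states `⟨time, init, decided, rd, #1⟩`. -/
structure BasicState (n : ℕ) where
  time : ℕ
  init : Val
  decided : Option Val
  rd : Option Val
  ones : Fin (n + 1)

/-- The messages `0`, `1` and `(init, 1)`. -/
inductive BasicMsg where
  | val (v : Val)
  | init1
deriving DecidableEq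

/-- The decision that a received message announces, if any. -/
def BasicMsg.announced : Option BasicMsg → Option Val
  | some (.val v) => some v
  | _ => none

/-- The number of `(init, 1)` messages received. -/
def countInit1 (ρ : Fin n → Option BasicMsg) : Fin (n + 1) :=
  ⟨(Finset.univ.filter fun j => ρ j = some .init1).card,
    Nat.lt_succ_of_le ((Finset.card_le_univ _).trans_eq (Fintype.card_fin n))⟩

/-- The messages sent to every agent in the basic information-exchange protocol. -/
def basicSend (s : BasicState n) : Action → Option BasicMsg
  | .decide v => some (.val v)
  | .noop => if s.init = 1 ∧ s.decided = none ∧ s.rd = none then some .init1 else none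

/-- The state update in the basic information-exchange protocol. -/
def basicUpdate (s : BasicState n) (a : Action) (ρ : Fin n → Option BasicMsg) : BasicState n where
  time := s.time + 1
  init := s.init
  decided := newDecided s.decided a
  rd := newRd fun j => BasicMsg.announced (ρ j)
  ones :=
    if newDecided s.decided a = none ∧ ¬ ∃ j v, ρ j = some (.val v) then countInit1 ρ else 0

/-- The basic information-exchange protocol. -/
abbrev basicExchange (n : ℕ) : InfoExchange n where
  L := fun _ => BasicState n
  I := fun _ => {s | ∃ v, s = ⟨0, v, none, none, 0⟩}
  M := fun _ => BasicMsg
  μ := fun _ s a _ => basicSend s a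
  δ := fun _ s a ρ => basicUpdate s a ρ

theorem BasicMsg.announced_eq_some (m : Option BasicMsg) (v : Val) :
    BasicMsg.announced m = some v ↔ m = some (.val v) := by
  rcases m with _ | (w | _) <;> simp [BasicMsg.announced]

/-- The basic context with `n` agents, at most `t` of them faulty. -/
abbrev basicContext (n t : ℕ) : EBAContext n where
  E := basicExchange n
  failures := SO n t
  time := fun _ s => BasicState.time s
  init := fun _ s => BasicState.init s
  decided := fun _ s => BasicState.decided s
  rd := fun _ s => BasicState.rd s
  time_initial := by rintro i s ⟨v, rfl⟩; rfl
  decided_initial := by rintro i s ⟨v, rfl⟩; rfl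
  rd_initial := by rintro i s ⟨v, rfl⟩; rfl
  Mdec := fun _ v => {some (BasicMsg.val v)}
  Moth := fun _ => {some BasicMsg.init1, none}
  disjoint_dec := fun _ => Set.disjoint_singleton.2
    fun h => absurd (BasicMsg.val.inj (Option.some.inj h)) (by decide)
  disjoint_oth := fun _ v => Set.disjoint_singleton_left.2 (by
    rintro (h | h) <;> cases h)
  none_notMem := fun _ v h => by cases h
  send_decide := fun _ _ _ _ => rfl
  send_noop := fun _ s _ => by
    change basicSend s .noop = some .init1 ∨ basicSend s .noop = none
    unfold basicSend
    split_ifs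
    · exact Or.inl rfl
    · exact Or.inr rfl
  time_δ := fun _ _ _ _ => rfl
  init_δ := fun _ _ _ _ => rfl
  decided_decide := fun _ _ _ _ => rfl
  decided_noop := fun _ _ _ => rfl
  rd_zero := fun _ _ _ _ ⟨j, hj⟩ => if_pos ⟨j, (BasicMsg.announced_eq_some _ _).2 hj⟩
  rd_one := fun _ _ _ _ h0 ⟨j, hj⟩ =>
    (if_neg fun ⟨k, hk⟩ => h0 ⟨k, (BasicMsg.announced_eq_some _ _).1 hk⟩).trans
      (if_pos ⟨j, (BasicMsg.announced_eq_some _ _).2 hj⟩)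
  rd_none := fun _ _ _ _ h =>
    (if_neg fun ⟨j, hj⟩ => h ⟨0, j, (BasicMsg.announced_eq_some _ _).1 hj⟩).trans
      (if_neg fun ⟨j, hj⟩ => h ⟨1, j, (BasicMsg.announced_eq_some _ _).1 hj⟩)

/-- The protocol `P^basic`. -/
def Pbasic (n t : ℕ) : ActionProtocol (basicContext n t).E := fun _ (s : BasicState n) =>
  if s.decided ≠ none then .noop
  else if s.init = 0 ∨ s.rd = some 0 then .decide 0
  else if ((s.ones : ℕ) : ℤ) > (n : ℤ) - (s.time : ℤ) ∨ s.rd = some 1 then .decide 1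
  else .noop

end EBA

namespace EBA

variable {n : ℕ}

/-! Both protocols decide 0 exactly on preferring 0 or on hearing of a fresh decision on 0. Hence a
decision on 0 at time `m` ends a chain of `m + 1` distinct agents that decided 0 in consecutive
rounds (`ZeroBiased.card_decided_zero`). A chain that reaches time `t` contains a nonfaulty agent,
and a nonfaulty decision on 0 makes every undecided agent decide 0 in the next round. So for `Pmin`
no conflict with 1 is possible at time `t + 1`. For `Pbasic`, chain members no longer send `(init,
1)`, so a count above `n - time` excludes a decision on 0 in the preceding round. Conversely, an
undecided agent that has heard of no decision counts at least `n - t` messages, which gives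
termination.

For optimality, let `P'` dominate `P`. By induction on time the two protocols act alike in reachable
states (`IsOptimalEBA.of_unique`). Since an action depends on the local state only, it can be
computed in any run of `P` in which the agent is nonfaulty and has the same local state: in a run
where all agents prefer 1, validity leaves `P'` only 1; in a run where a chain of faulty agents
passes 0 to a nonfaulty agent that decides it at time `m` (`chainPattern`), agreement forbids
another nonfaulty agent to decide 1 at time `m`; one round later, agreement forces such an agent to
decide 0. Where `P` decides, `P'` must decide too, and one such run fixes the value. Where an
undecided agent stays inactive under `P`, its state occurs in runs of both of the first two kinds,
so `P'` can decide neither value. For `Pbasic` the runs must also reproduce the count, which is done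
by choosing the number of silent faulty agents. -/

theorem val_eq_zero_of_ne_one {v : Val} (h : v ≠ 1) : v = 0 := by
  revert v; decide

/-! ### Runs -/

/-- The run of `P` that starts in a given global state. -/
def runFrom {E : InfoExchange n} (P : ActionProtocol E) (g : GlobalState E) : Run E
  | 0 => g
  | k + 1 => step P k (runFrom P g k)

section Runs

variable {γ : EBAContext n} {P P' : ActionProtocol γ.E} {r : Run γ.E}

theorem runFrom_mem {g : GlobalState γ.E} (hf : g.env ∈ γ.failures)
    (hi : ∀ i, g.loc i ∈ γ.E.I i) : runFrom P g ∈ γ.runs P :=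
  ⟨hf, hi, fun _ => rfl⟩

theorem env_eq (hr : r ∈ γ.runs P) (m : ℕ) : (r m).env = (r 0).env := by
  induction m with
  | zero => rfl
  | succ m ih => rw [hr.2.2 m]; exact ih

theorem loc_succ (hr : r ∈ γ.runs P) (m : ℕ) (i : Fin n) :
    (r (m + 1)).loc i =
      γ.E.δ i ((r m).loc i) (P i ((r m).loc i)) fun j => delivered P m (r m) j i := by
  rw [hr.2.2 m]; rfl

theorem time_eq (hr : r ∈ γ.runs P) (m : ℕ) (i : Fin n) : γ.time i ((r m).loc i) = m := by
  induction m with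
  | zero => exact γ.time_initial i _ (hr.2.1 i)
  | succ m ih => rw [loc_succ hr, γ.time_δ, ih]

theorem init_eq (hr : r ∈ γ.runs P) (m : ℕ) (i : Fin n) :
    γ.init i ((r m).loc i) = γ.init i ((r 0).loc i) := by
  induction m with
  | zero => rfl
  | succ m ih => rw [loc_succ hr, γ.init_δ, ih]

theorem decided_zero (hr : r ∈ γ.runs P) (i : Fin n) : γ.decided i ((r 0).loc i) = none :=
  γ.decided_initial i _ (hr.2.1 i)

theorem rd_zero_time (hr : r ∈ γ.runs P) (i : Fin n) : γ.rd i ((r 0).loc i) = none :=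
  γ.rd_initial i _ (hr.2.1 i)

theorem decided_succ (hr : r ∈ γ.runs P) (m : ℕ) (i : Fin n) :
    γ.decided i ((r (m + 1)).loc i) =
      newDecided (γ.decided i ((r m).loc i)) (P i ((r m).loc i)) := by
  rw [loc_succ hr]
  cases P i ((r m).loc i) with
  | decide v => exact γ.decided_decide _ _ _ _
  | noop => exact γ.decided_noop _ _ _

theorem mem_Mdec_iff (i : Fin n) (s : γ.E.L i) (a : Action) (j : Fin n) (v : Val) :
    γ.E.μ i s a j ∈ γ.Mdec i v ↔ a = .decide v := by
  constructor
  · intro h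
    cases a with
    | noop => exact absurd (γ.send_noop i s j) (Set.disjoint_left.1 (γ.disjoint_oth i v) h)
    | decide w =>
      have hw := γ.send_decide i s w j
      have hd := Set.disjoint_left.1 (γ.disjoint_dec i)
      fin_cases v <;> fin_cases w
      · rfl
      · exact absurd hw (hd h)
      · exact absurd h (hd hw)
      · rfl
  · rintro rfl
    exact γ.send_decide i s v j

theorem delivered_mem_Mdec_iff (k : ℕ) (g : GlobalState γ.E) (i j : Fin n) (v : Val) :
    delivered P k g i j ∈ γ.Mdec i v ↔ g.env.F k i j = true ∧ P i (g.loc i) = .decide v := by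
  unfold delivered
  split_ifs with h
  · rw [mem_Mdec_iff]; simp [h]
  · simp [h, γ.none_notMem]

/-- Announcements of 0 take priority over those of 1, so hearing 0 is characterized exactly. For 1
the two directions are separate, and the converse `rd_succ_eq_one` needs the absence of decisions on
0. -/
theorem rd_succ_eq_zero_iff (hr : r ∈ γ.runs P) (m : ℕ) (i : Fin n) :
    γ.rd i ((r (m + 1)).loc i) = some 0 ↔
      ∃ j, (r 0).env.F m j i = true ∧ P j ((r m).loc j) = .decide 0 := by
  simp only [← env_eq hr m, ← delivered_mem_Mdec_iff]
  rw [loc_succ hr]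
  constructor
  · intro h
    by_contra h0
    by_cases h1 : ∃ j, delivered P m (r m) j i ∈ γ.Mdec j 1
    · rw [γ.rd_one _ _ _ _ h0 h1] at h
      exact absurd (Option.some.inj h) (by decide)
    · rw [γ.rd_none _ _ _ _ (by
        rintro ⟨v, j, hj⟩
        fin_cases v
        exacts [h0 ⟨j, hj⟩, h1 ⟨j, hj⟩])] at h
      cases h
  · exact γ.rd_zero _ _ _ _

theorem exists_of_rd_succ_eq_one (hr : r ∈ γ.runs P) {m : ℕ} {i : Fin n}
    (h : γ.rd i ((r (m + 1)).loc i) = some 1) :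
    ∃ j, (r 0).env.F m j i = true ∧ P j ((r m).loc j) = .decide 1 := by
  by_contra h1
  have h0 : ¬ γ.rd i ((r (m + 1)).loc i) = some 0 := by
    rw [h]; exact fun h => absurd (Option.some.inj h) (by decide)
  rw [rd_succ_eq_zero_iff hr] at h0
  simp only [← env_eq hr m, ← delivered_mem_Mdec_iff] at h0 h1
  rw [loc_succ hr, γ.rd_none _ _ _ _ (by
    rintro ⟨v, j, hj⟩
    fin_cases v
    exacts [h0 ⟨j, hj⟩, h1 ⟨j, hj⟩])] at h
  cases h

theorem rd_succ_eq_one (hr : r ∈ γ.runs P) {m : ℕ} {i : Fin n}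
    (h0 : ∀ j, P j ((r m).loc j) ≠ .decide 0)
    (h1 : ∃ j, (r 0).env.F m j i = true ∧ P j ((r m).loc j) = .decide 1) :
    γ.rd i ((r (m + 1)).loc i) = some 1 := by
  simp only [← env_eq hr m, ← delivered_mem_Mdec_iff] at h1
  rw [loc_succ hr]
  refine γ.rd_one _ _ _ _ ?_ h1
  simp only [delivered_mem_Mdec_iff]
  exact fun ⟨j, hj⟩ => h0 j hj.2

theorem rd_succ_ne_none (hr : r ∈ γ.runs P) {m : ℕ} {i j : Fin n} {v : Val}
    (hF : (r 0).env.F m j i = true) (hj : P j ((r m).loc j) = .decide v) :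
    γ.rd i ((r (m + 1)).loc i) ≠ none := by
  by_cases h0 : ∃ k, delivered P m (r m) k i ∈ γ.Mdec k 0
  · rw [loc_succ hr, γ.rd_zero _ _ _ _ h0]; simp
  · have hv : delivered P m (r m) j i ∈ γ.Mdec j v := by
      rw [delivered_mem_Mdec_iff, env_eq hr]; exact ⟨hF, hj⟩
    rw [loc_succ hr, γ.rd_one _ _ _ _ h0 ⟨j, ?_⟩]
    · simp
    · fin_cases v
      exacts [absurd ⟨j, hv⟩ h0, hv]

theorem rd_succ_eq_none (hr : r ∈ γ.runs P) {m : ℕ} {i : Fin n}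
    (h : ∀ j, (r 0).env.F m j i = true → ∀ v, P j ((r m).loc j) ≠ .decide v) :
    γ.rd i ((r (m + 1)).loc i) = none := by
  rw [loc_succ hr]
  refine γ.rd_none _ _ _ _ ?_
  rintro ⟨v, j, hj⟩
  rw [delivered_mem_Mdec_iff, env_eq hr] at hj
  exact h j hj.1 v hj.2

theorem decided_mono (hr : r ∈ γ.runs P) {m m' : ℕ} (h : m ≤ m') {i : Fin n}
    (hd : γ.decided i ((r m).loc i) ≠ none) : γ.decided i ((r m').loc i) ≠ none := by
  induction m', h using Nat.le_induction with
  | base => exact hd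
  | succ m' _ ih =>
    rw [decided_succ hr]
    cases P i ((r m').loc i) <;> simp [newDecided, ih]

theorem decided_succ_of_decide (hr : r ∈ γ.runs P) {m : ℕ} {i : Fin n} {v : Val}
    (h : P i ((r m).loc i) = .decide v) : γ.decided i ((r (m + 1)).loc i) = some v := by
  rw [decided_succ hr, h]; rfl

theorem decided_ne_none_of_decide (hr : r ∈ γ.runs P) {m m' : ℕ} (hm : m < m') {i : Fin n}
    {v : Val} (h : P i ((r m).loc i) = .decide v) : γ.decided i ((r m').loc i) ≠ none :=
  decided_mono hr hm (by rw [decided_succ_of_decide hr h]; simp)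

theorem exists_decide_of_decided (hr : r ∈ γ.runs P) {m : ℕ} {i : Fin n} {v : Val}
    (h : γ.decided i ((r m).loc i) = some v) : ∃ k < m, P i ((r k).loc i) = .decide v := by
  induction m with
  | zero => rw [decided_zero hr] at h; cases h
  | succ m ih =>
    rw [decided_succ hr] at h
    cases ha : P i ((r m).loc i) with
    | decide w =>
      rw [ha] at h
      exact ⟨m, m.lt_succ_self, ha.trans (congrArg _ (Option.some.inj h))⟩
    | noop =>
      rw [ha] at h
      obtain ⟨k, hk, hv⟩ := ih h
      exact ⟨k, hk.trans m.lt_succ_self, hv⟩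

/-! ### Comparing protocols -/

/-- The two protocols perform the same actions before time `m` in all runs of the first. -/
def AgreeBefore (γ : EBAContext n) (P P' : ActionProtocol γ.E) (m : ℕ) : Prop :=
  ∀ r ∈ γ.runs P, ∀ k < m, ∀ i, P' i ((r k).loc i) = P i ((r k).loc i)

/-- Time `m` itself is included, because the state at `m` depends only on actions before `m`. This
allows the EBA properties of `P'` to be applied to its still unknown action at time `m`. -/
theorem AgreeBefore.runFrom_eq {m : ℕ} (h : AgreeBefore γ P P' m) (hr : r ∈ γ.runs P) :
    ∀ k ≤ m, runFrom P' (r 0) k = r k := by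
  intro k hk
  induction k with
  | zero => rfl
  | succ k ih =>
    have ih := ih (by omega)
    rw [hr.2.2 k, runFrom, ih]
    have hP : ∀ i, P' i ((r k).loc i) = P i ((r k).loc i) := h r hr k (by omega)
    simp only [step, delivered, hP]

/-- By termination `P'` decides at some time `k`. If `k < m`, then `P` decided at `k` as well and
would decide twice; if `k > m`, domination fails. -/
theorem AgreeBefore.exists_decide {m : ℕ} (h : AgreeBefore γ P P' m)
    (hP : IsEBADecisionProtocol γ P) (hP' : IsEBADecisionProtocol γ P')
    (hdom : Dominates γ P' P) (hr : r ∈ γ.runs P) {i : Fin n} (hi : i ∈ (r 0).env.N) {v : Val}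
    (hv : P i ((r m).loc i) = .decide v) : ∃ w, P' i ((r m).loc i) = .decide w := by
  have hr' : runFrom P' (r 0) ∈ γ.runs P' := runFrom_mem hr.1 hr.2.1
  obtain ⟨m', -, hm'⟩ := hP'.termination _ hr' 0 i hi
  obtain ⟨w, hw⟩ := Option.ne_none_iff_exists'.1 hm'
  obtain ⟨k, -, hk⟩ := exists_decide_of_decided hr' hw
  rcases lt_trichotomy k m with hkm | rfl | hkm
  · rw [h.runFrom_eq hr k hkm.le, h r hr k hkm] at hk
    have := hP.decidesOnce r hr m i (decided_ne_none_of_decide hr hkm hk)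
    rw [this] at hv
    cases hv
  · rw [h.runFrom_eq hr k le_rfl] at hk
    exact ⟨w, hk⟩
  · exact absurd hv (hdom _ hr' r hr rfl i hi k w hk m hkm v)

theorem AgreeBefore.exists_init {m : ℕ} (h : AgreeBefore γ P P' m)
    (hP' : IsEBADecisionProtocol γ P') (hr : r ∈ γ.runs P) {i : Fin n} (hi : i ∈ (r 0).env.N)
    {w : Val} (hw : P' i ((r m).loc i) = .decide w) : ∃ j, γ.init j ((r 0).loc j) = w := by
  have hr' : runFrom P' (r 0) ∈ γ.runs P' := runFrom_mem hr.1 hr.2.1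
  rw [← h.runFrom_eq hr m le_rfl] at hw
  obtain ⟨j, hj⟩ := hP'.validity _ hr' (m + 1) i w (decided_succ_of_decide hr' hw)
    (by rw [env_eq hr']; exact hi)
  exact ⟨j, by rw [init_eq hr'] at hj; exact hj⟩

/-- This is agreement of `P'` at time `m + 1`, so it covers both an earlier decision of `j` and one
made in the same round as that of `i`. -/
theorem AgreeBefore.eq_of_decide {m : ℕ} (h : AgreeBefore γ P P' m)
    (hP' : IsEBADecisionProtocol γ P') (hr : r ∈ γ.runs P) {i j : Fin n}
    (hi : i ∈ (r 0).env.N) (hj : j ∈ (r 0).env.N) {v w : Val}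
    (hv : P' i ((r m).loc i) = .decide v)
    (hw : γ.decided j ((r m).loc j) = some w ∨ P' j ((r m).loc j) = .decide w) : v = w := by
  have hr' : runFrom P' (r 0) ∈ γ.runs P' := runFrom_mem hr.1 hr.2.1
  rw [← h.runFrom_eq hr m le_rfl] at hv hw
  by_contra hne
  refine hP'.agreement _ hr' (m + 1) i j v w hne
    ⟨by rw [env_eq hr']; exact hi, by rw [env_eq hr']; exact hj,
      decided_succ_of_decide hr' hv, ?_⟩
  rcases hw with hw | hw
  · have := hP'.decidesOnce _ hr' m j (by rw [hw]; simp)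
    rw [decided_succ hr', this, hw]; rfl
  · exact decided_succ_of_decide hr' hw

/-- A protocol is optimal if every protocol that dominates it performs the same actions in all
reachable states in which no decision has been made. -/
theorem IsOptimalEBA.of_unique (hP : IsEBADecisionProtocol γ P)
    (h : ∀ P', IsEBADecisionProtocol γ P' → Dominates γ P' P → ∀ m, AgreeBefore γ P P' m →
      ∀ r ∈ γ.runs P, ∀ i, γ.decided i ((r m).loc i) = none →
        P' i ((r m).loc i) = P i ((r m).loc i)) : IsOptimalEBA γ P := by
  refine ⟨hP, fun P' hP' ⟨hdom, hnot⟩ => hnot ?_⟩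
  have key : ∀ m, AgreeBefore γ P P' m := by
    intro m
    induction m with
    | zero => intro r _ k hk; omega
    | succ m ih =>
      intro r hr k hk i
      rcases Nat.lt_succ_iff_lt_or_eq.1 hk with hk | rfl
      · exact ih r hr k hk i
      -- Once the agent has decided, single decision forces `noop` on both protocols.
      · by_cases hd : γ.decided i ((r k).loc i) = none
        · exact h P' hP' hdom k ih r hr i hd
        · rw [hP.decidesOnce r hr k i hd]
          have hr' : runFrom P' (r 0) ∈ γ.runs P' := runFrom_mem hr.1 hr.2.1
          have := hP'.decidesOnce _ hr' k i
          rw [ih.runFrom_eq hr k le_rfl] at this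
          exact this hd
  intro r hr r' hr' h0 i hi m v hv m' hm' w hw
  have heq : ∀ k, r' k = runFrom P' (r 0) k := by
    intro k
    induction k with
    | zero => exact h0.symm
    | succ k ih => rw [hr'.2.2, ih]; rfl
  rw [heq, (key m').runFrom_eq hr m' le_rfl, key (m' + 1) r hr m' m'.lt_succ_self] at hw
  rw [hP.decidesOnce r hr m i (decided_ne_none_of_decide hr hm' hw)] at hv
  cases hv

theorem agreement_of_not_conflict (h : ∀ r ∈ γ.runs P, ∀ i ∈ (r 0).env.N, ∀ j ∈ (r 0).env.N, ∀ m m',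
    P i ((r m).loc i) = .decide 0 → P j ((r m').loc j) = .decide 1 → False) : Agreement γ P := by
  rintro r hr m i j v w hne ⟨hi, hj, hv, hw⟩
  rw [env_eq hr] at hi hj
  obtain ⟨k, -, hk⟩ := exists_decide_of_decided hr hv
  obtain ⟨l, -, hl⟩ := exists_decide_of_decided hr hw
  fin_cases v <;> fin_cases w
  · exact hne rfl
  · exact h r hr i hi j hj k l hk hl
  · exact h r hr j hj i hi l k hl hk
  · exact hne rfl

/-! ### Protocols that decide `0` as soon as possible -/

/-- Decided agents do nothing, and undecided agents decide `0` exactly if they prefer `0` or have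
just heard of a decision on `0`. -/
structure ZeroBiased (γ : EBAContext n) (P : ActionProtocol γ.E) : Prop where
  noop_of_decided : ∀ i s, γ.decided i s ≠ none → P i s = .noop
  decide_zero_iff : ∀ i s, P i s = .decide 0 ↔
    γ.decided i s = none ∧ (γ.init i s = 0 ∨ γ.rd i s = some 0)

namespace ZeroBiased

variable (hP : ZeroBiased γ P)
include hP

theorem decidesOnce : DecidesOnce γ P := fun _ _ _ _ h => hP.noop_of_decided _ _ h

theorem decided_eq_none_of_decide {i : Fin n} {s : γ.E.L i} {v : Val} (h : P i s = .decide v) :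
    γ.decided i s = none := by
  by_contra hd
  rw [hP.noop_of_decided i s hd] at h
  cases h

theorem decided_eq_of_le (hr : r ∈ γ.runs P) {m m' : ℕ} (h : m ≤ m') {i : Fin n} {v : Val}
    (hd : γ.decided i ((r m).loc i) = some v) : γ.decided i ((r m').loc i) = some v := by
  induction m', h using Nat.le_induction with
  | base => exact hd
  | succ m' _ ih =>
    rw [decided_succ hr, hP.noop_of_decided i _ (by rw [ih]; simp), ih]; rfl

theorem uniqueDecision : UniqueDecision γ P := by
  intro r hr m i v hv m' hm' h
  rw [hP.decided_eq_of_le hr hm' hv] at h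
  have := Option.some.inj h
  revert this
  fin_cases v <;> decide

theorem init_eq_one_of_undecided_succ (hr : r ∈ γ.runs P) {m : ℕ} {i : Fin n}
    (h : γ.decided i ((r (m + 1)).loc i) = none) : γ.init i ((r 0).loc i) = 1 := by
  by_contra h1
  have h0 := val_eq_zero_of_ne_one h1
  exact decided_ne_none_of_decide hr m.succ_pos
    ((hP.decide_zero_iff _ _).2 ⟨decided_zero hr i, Or.inl h0⟩) h

theorem rd_eq_zero_of_decide_succ (hr : r ∈ γ.runs P) {m : ℕ} {i : Fin n}
    (h : P i ((r (m + 1)).loc i) = .decide 0) : γ.rd i ((r (m + 1)).loc i) = some 0 := by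
  obtain ⟨hd, h0 | h0⟩ := (hP.decide_zero_iff _ _).1 h
  · rw [init_eq hr, hP.init_eq_one_of_undecided_succ hr hd] at h0
    exact absurd h0 (by decide)
  · exact h0

/-- After time 0, deciding 0 requires a decision on 0 in the round just before, so the decisions on
0 leave no gap in time. -/
theorem no_zero_of_le (hr : r ∈ γ.runs P) {m m' : ℕ} (h : m ≤ m')
    (h0 : ∀ i, P i ((r m).loc i) ≠ .decide 0) (i : Fin n) : P i ((r m').loc i) ≠ .decide 0 := by
  induction m', h using Nat.le_induction generalizing i with
  | base => exact h0 i
  | succ m' _ ih =>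
    intro h
    obtain ⟨j, -, hj⟩ := (rd_succ_eq_zero_iff hr m' i).1 (hP.rd_eq_zero_of_decide_succ hr h)
    exact ih j hj

/-- Each link of the chain that leads to `i` adds an agent that was undecided until then, so the set
of agents decided on 0 grows strictly with each round. -/
theorem card_decided_zero (hr : r ∈ γ.runs P) {m : ℕ} {i : Fin n}
    (h : P i ((r m).loc i) = .decide 0) :
    m + 1 ≤ (Finset.univ.filter fun j => γ.decided j ((r (m + 1)).loc j) = some 0).card := by
  induction m generalizing i with
  | zero =>
    exact Finset.card_pos.2 ⟨i, by simpa using decided_succ_of_decide hr h⟩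
  | succ m ih =>
    obtain ⟨j, -, hj⟩ := (rd_succ_eq_zero_iff hr m i).1 (hP.rd_eq_zero_of_decide_succ hr h)
    refine (Nat.succ_le_succ (ih hj)).trans (Nat.succ_le_of_lt (Finset.card_lt_card ?_))
    refine Finset.ssubset_iff_subset_ne.2 ⟨fun k hk => ?_, fun he => ?_⟩
    · simp only [Finset.mem_filter, Finset.mem_univ, true_and] at hk ⊢
      exact hP.decided_eq_of_le hr (m + 1).le_succ hk
    · have hi : i ∈ Finset.univ.filter fun j => γ.decided j ((r (m + 1 + 1)).loc j) = some 0 := by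
        simpa using decided_succ_of_decide hr h
      rw [← he] at hi
      have hd := hP.decided_eq_none_of_decide h
      simp [hd] at hi

theorem validity : Validity γ P := by
  intro r hr m i v hv _
  obtain ⟨k, -, hk⟩ := exists_decide_of_decided hr hv
  simp only [init_eq hr m]
  by_cases h0 : v = 0
  · subst h0
    by_contra hno
    exact hP.no_zero_of_le hr k.zero_le (fun j hj => hno ⟨j, by
      rcases ((hP.decide_zero_iff _ _).1 hj).2 with h | h
      · exact h
      · rw [rd_zero_time hr] at h; cases h⟩) i hk
  · refine ⟨i, ?_⟩
    by_contra h1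
    have hv1 : v = 1 := by_contra fun h => h0 (val_eq_zero_of_ne_one h)
    have hz : γ.init i ((r k).loc i) = 0 := by
      rw [init_eq hr]; exact val_eq_zero_of_ne_one (hv1 ▸ h1)
    have := (hP.decide_zero_iff i _).2 ⟨hP.decided_eq_none_of_decide hk, Or.inl hz⟩
    rw [hk] at this
    exact h0 (Action.decide.inj this)

/-- A nonfaulty decision on `0` makes every agent decide within one round. -/
theorem decided_of_nonfaulty_zero (hr : r ∈ γ.runs P)
    (hF : ∀ m i j, j ∈ (r 0).env.N → (r 0).env.F m j i = true) {m m' : ℕ} (hm : m < m')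
    {i j : Fin n} (hj : j ∈ (r 0).env.N) (h : P j ((r m).loc j) = .decide 0)
    (hd : γ.decided i ((r m').loc i) = none) : P i ((r m').loc i) = .decide 0 := by
  have hrd := (rd_succ_eq_zero_iff hr m i).2 ⟨j, hF m i j hj, h⟩
  have hd' : γ.decided i ((r (m + 1)).loc i) = none := by
    by_contra h'
    exact decided_mono hr hm h' hd
  have hi := (hP.decide_zero_iff i _).2 ⟨hd', Or.inr hrd⟩
  rcases Nat.eq_or_lt_of_le (Nat.succ_le_of_lt hm) with rfl | hlt
  · exact hi
  · exact absurd hd (decided_ne_none_of_decide hr hlt hi)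

end ZeroBiased

end Runs

/-! ### Basic facts on sending omissions -/

theorem SO.deliver_of_mem {t : ℕ} {α : FailurePattern n} (hα : α ∈ SO n t) (m : ℕ) (i j : Fin n)
    (hj : j ∈ α.N) : α.F m j i = true := by
  by_contra h
  exact hα.2 m j i (by simpa using h) hj

theorem SO.exists_mem_of_lt_card {t : ℕ} {α : FailurePattern n} (hα : α ∈ SO n t)
    {S : Finset (Fin n)} (hS : t < S.card) : ∃ j ∈ S, j ∈ α.N := by
  by_contra! h
  have : S ⊆ (α.N)ᶜ := fun j hj => by simpa using h j hj
  exact absurd (Finset.card_le_card this) (by have := hα.1; omega)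

/-! ### Failure patterns -/

/-- The agents of `A` are faulty, and they deliver only the messages that `G` lets through. -/
def omission (A : Finset (Fin n)) (G : ℕ → Fin n → Fin n → Prop) [∀ k a b, Decidable (G k a b)] :
    FailurePattern n where
  N := Aᶜ
  F k a b := decide (a ∉ A ∨ G k a b)

theorem omission_mem {t : ℕ} {A : Finset (Fin n)} (hA : A.card ≤ t)
    (G : ℕ → Fin n → Fin n → Prop) [∀ k a b, Decidable (G k a b)] : omission A G ∈ SO n t := by
  refine ⟨by simpa [omission] using hA, fun m i j h => ?_⟩
  simp only [omission, decide_eq_false_iff_not, not_or, not_not] at h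
  simpa [omission] using h.1

/-- The agents of rank at most `d`, except for the one of rank `m`. -/
def chainSet (e : Fin n ≃ Fin n) (m d : ℕ) : Finset (Fin n) :=
  Finset.univ.filter fun a => (e a : ℕ) ≤ d ∧ (e a : ℕ) ≠ m

theorem mem_chainSet {e : Fin n ≃ Fin n} {m d : ℕ} {a : Fin n} :
    a ∈ chainSet e m d ↔ (e a : ℕ) ≤ d ∧ (e a : ℕ) ≠ m := by
  simp [chainSet]

theorem card_chainSet (e : Fin n ≃ Fin n) {m d : ℕ} (hm : m ≤ d) (hd : d < n) :
    (chainSet e m d).card = d := by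
  have h : (chainSet e m d).map (e.toEmbedding.trans Fin.valEmbedding) =
      (Finset.range (d + 1)).erase m := by
    ext k
    simp only [Finset.mem_map, mem_chainSet, Finset.mem_erase, Finset.mem_range]
    constructor
    · rintro ⟨a, ⟨h1, h2⟩, rfl⟩
      exact ⟨h2, Nat.lt_succ_of_le h1⟩
    · rintro ⟨h1, h2⟩
      exact ⟨e.symm ⟨k, by omega⟩, by simpa using ⟨by omega, h1⟩, by simp⟩
  rw [← Finset.card_map, h, Finset.card_erase_of_mem (by simp; omega), Finset.card_range]
  rfl

/-- Faulty agents send only along a chain that visits the agents in the order of their ranks. -/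
def chainPattern (e : Fin n ≃ Fin n) (m d : ℕ) : FailurePattern n :=
  omission (chainSet e m d) fun k a b => (e a : ℕ) = k ∧ (e b : ℕ) = k + 1

theorem chainPattern_F {e : Fin n ≃ Fin n} {m d k : ℕ} {a b : Fin n} :
    (chainPattern e m d).F k a b = true ↔
      a ∉ chainSet e m d ∨ ((e a : ℕ) = k ∧ (e b : ℕ) = k + 1) := by
  simp [chainPattern, omission]

theorem chainPattern_N {e : Fin n ≃ Fin n} {m d : ℕ} {a : Fin n} :
    a ∈ (chainPattern e m d).N ↔ a ∉ chainSet e m d := by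
  simp [chainPattern, omission]

/-- A ranking in which a given agent comes last. -/
theorem exists_rank (hn : 0 < n) (i : Fin n) : ∃ e : Fin n ≃ Fin n, (e i : ℕ) = n - 1 :=
  ⟨Equiv.swap i ⟨n - 1, by omega⟩, by simp⟩

/-- The preferences along the chain: only the first agent prefers `0`. -/
def chainInit (e : Fin n ≃ Fin n) (a : Fin n) : Val := if (e a : ℕ) = 0 then 0 else 1

theorem chainInit_of_pos {e : Fin n ≃ Fin n} {a : Fin n} (h : 0 < (e a : ℕ)) :
    chainInit e a = 1 := if_neg (by omega)

/-! ### Runs in which faulty agents pass on 0, and what they force on dominating protocols -/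

section Chains

variable {γ : EBAContext n} {P P' : ActionProtocol γ.E} {r : Run γ.E}

/-- In a run with a chain pattern, exactly the agents along the chain decide. -/
theorem ZeroBiased.chain_run (hP : ZeroBiased γ P) (hr : r ∈ γ.runs P) {e : Fin n ≃ Fin n}
    {m d : ℕ} (hd : m ≤ d) (henv : (r 0).env = chainPattern e m d)
    (hinit : ∀ a, γ.init a ((r 0).loc a) = chainInit e a)
    (h0 : ∀ a, P a ((r 0).loc a) ≠ .decide 1)
    (h1 : ∀ k < m, ∀ a b, P b ((r k).loc b) = .decide 0 →
      P a ((r (k + 1)).loc a) ≠ .decide 1) (hm : m < n) :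
    ∀ k ≤ m, (∀ a, γ.decided a ((r k).loc a) = if (e a : ℕ) < k then some 0 else none) ∧
      (∀ a, k ≤ e a → γ.rd a ((r k).loc a) = if (e a : ℕ) = k ∧ 0 < k then some 0 else none) ∧
      ∀ a v, P a ((r k).loc a) = .decide v ↔ (e a : ℕ) = k ∧ v = 0 := by
  intro k
  induction k with
  | zero =>
    intro _
    refine ⟨fun a => by simpa using decided_zero hr a, fun a _ => by
      simpa using rd_zero_time hr a, fun a v => ?_⟩
    by_cases hv : v = 1
    · subst hv
      exact iff_of_false (h0 a) (fun h => absurd h.2 (by decide))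
    · obtain rfl := val_eq_zero_of_ne_one hv
      rw [hP.decide_zero_iff, hinit, rd_zero_time hr, decided_zero hr, chainInit]
      split_ifs with h <;> simp [h]
  | succ k ih =>
    intro hk
    obtain ⟨ihd, -, iha⟩ := ih (by omega)
    have hdec : ∀ a, γ.decided a ((r (k + 1)).loc a) =
        if (e a : ℕ) < k + 1 then some 0 else none := by
      intro a
      by_cases ha : (e a : ℕ) = k
      · rw [decided_succ_of_decide hr ((iha a 0).2 ⟨ha, rfl⟩), if_pos (by omega)]
      · rw [decided_succ hr]
        cases hact : P a ((r k).loc a) with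
        | decide v => exact absurd ((iha a v).1 hact).1 ha
        | noop =>
          rw [newDecided, ihd]
          exact if_congr (by omega) rfl rfl
    have hrd : ∀ a, k + 1 ≤ e a → γ.rd a ((r (k + 1)).loc a) =
        if (e a : ℕ) = k + 1 ∧ 0 < k + 1 then some 0 else none := by
      intro a ha
      split_ifs with he
      · rw [rd_succ_eq_zero_iff hr]
        have hek : (e (e.symm ⟨k, by omega⟩) : ℕ) = k := by simp
        refine ⟨e.symm ⟨k, by omega⟩, ?_, (iha _ _).2 ⟨hek, rfl⟩⟩
        rw [henv, chainPattern_F]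
        exact Or.inr ⟨hek, he.1⟩
      -- The only sender has rank `k < m ≤ d`, so it is faulty and reaches only the agent of rank `k
      -- + 1`.
      · refine rd_succ_eq_none hr fun b hF v hb => ?_
        rw [henv, chainPattern_F, mem_chainSet] at hF
        have := ((iha b v).1 hb).1
        rcases hF with hF | hF <;> omega
    refine ⟨hdec, hrd, fun a v => ?_⟩
    by_cases hv : v = 1
    · subst hv
      have hek : (e (e.symm ⟨k, by omega⟩) : ℕ) = k := by simp
      exact iff_of_false (h1 k (by omega) a _ ((iha _ _).2 ⟨hek, rfl⟩))
        (fun h => absurd h.2 (by decide))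
    · obtain rfl := val_eq_zero_of_ne_one hv
      rw [hP.decide_zero_iff, init_eq hr, hinit, hdec]
      by_cases ha : (e a : ℕ) < k + 1
      · simp [ha]; omega
      · rw [hrd a (by omega), chainInit_of_pos (by omega)]
        simp [ha]

/-- The properties of a zero-biased protocol in a sending-omissions context that determine when
the protocols that dominate it decide `0`. -/
structure ZeroChainProtocol (γ : EBAContext n) (P : ActionProtocol γ.E) (t : ℕ) : Prop
    extends ZeroBiased γ P where
  failures_eq : γ.failures = SO n t
  exists_initial : ∀ v : Fin n → Val, ∃ s : ∀ i, γ.E.L i, (∀ i, s i ∈ γ.E.I i) ∧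
    ∀ i, γ.init i (s i) = v i
  not_one_zero : ∀ r ∈ γ.runs P, ∀ i, P i ((r 0).loc i) ≠ .decide 1
  not_one_succ : ∀ r ∈ γ.runs P, ∀ k < t, ∀ i j, P j ((r k).loc j) = .decide 0 →
    P i ((r (k + 1)).loc i) ≠ .decide 1
  state_eq : ∀ r ∈ γ.runs P, ∀ r' ∈ γ.runs P, ∀ m i,
    γ.init i ((r 0).loc i) = γ.init i ((r' 0).loc i) → P i ((r m).loc i) = .decide 0 →
      P i ((r' m).loc i) = .decide 0 → (r m).loc i = (r' m).loc i

namespace ZeroChainProtocol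

variable {t : ℕ} (hP : ZeroChainProtocol γ P t)
include hP

theorem exists_run {α : FailurePattern n} (hα : α ∈ SO n t) (v : Fin n → Val) :
    ∃ r ∈ γ.runs P, (r 0).env = α ∧ ∀ i, γ.init i ((r 0).loc i) = v i := by
  obtain ⟨s, hs, hv⟩ := hP.exists_initial v
  exact ⟨runFrom P ⟨α, s⟩, runFrom_mem (by rw [hP.failures_eq]; exact hα) hs, rfl, hv⟩

theorem env_mem (hr : r ∈ γ.runs P) : (r 0).env ∈ SO n t := hP.failures_eq ▸ hr.1

theorem deliver (hr : r ∈ γ.runs P) (m : ℕ) (i j : Fin n) (hj : j ∈ (r 0).env.N) :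
    (r 0).env.F m j i = true :=
  SO.deliver_of_mem (hP.env_mem hr) m i j hj

/-- If some agent decides `0` at time `t` or later, then a nonfaulty agent does so by time `t`. -/
theorem exists_nonfaulty_zero (hr : r ∈ γ.runs P) {m : ℕ} (hm : t ≤ m) {i : Fin n}
    (h : P i ((r m).loc i) = .decide 0) :
    ∃ j ∈ (r 0).env.N, ∃ k ≤ t, P j ((r k).loc j) = .decide 0 := by
  obtain ⟨a, ha⟩ : ∃ a, P a ((r t).loc a) = .decide 0 := by
    by_contra! hno
    exact hP.no_zero_of_le hr hm hno i h
  obtain ⟨j, hj, hjN⟩ := SO.exists_mem_of_lt_card (hP.env_mem hr) (hP.card_decided_zero hr ha)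
  obtain ⟨k, hk, hjk⟩ := exists_decide_of_decided hr (Finset.mem_filter.1 hj).2
  exact ⟨j, hjN, k, by omega, hjk⟩

theorem le_of_decide_zero (hr : r ∈ γ.runs P) {m : ℕ} {i : Fin n}
    (h : P i ((r m).loc i) = .decide 0) : m ≤ t + 1 := by
  by_contra! hm
  obtain ⟨j, hj, k, hk, hjk⟩ := hP.exists_nonfaulty_zero hr (by omega) h
  -- The nonfaulty decision by time `t` makes `i` decide by time `t + 1`, too early for a decision
  -- at `m`.
  have hdm := hP.decided_eq_none_of_decide h
  have hd : γ.decided i ((r (t + 1)).loc i) = none := by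
    by_contra hd
    exact decided_mono hr hm.le hd hdm
  exact decided_ne_none_of_decide hr hm
    (hP.decided_of_nonfaulty_zero hr (hP.deliver hr) (Nat.lt_succ_of_le hk) hj hjk hd) hdm

/-- The observer `i` gets the last rank `n - 1 > t ≥ d`. It is therefore nonfaulty and distinct from
the nonfaulty agent of rank `m` at which the chain surfaces; this is where `t ≤ n - 2` enters. The
faulty agents of rank above `m` serve only to adjust the number of messages that `i` receives. -/
theorem exists_chain_run (i : Fin n) {m d : ℕ} (hm : m ≤ d) (hd : d ≤ t) (ht : t + 2 ≤ n) :
    ∃ e : Fin n ≃ Fin n, (e i : ℕ) = n - 1 ∧ ∃ r ∈ γ.runs P, (r 0).env = chainPattern e m d ∧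
      ∀ a, γ.init a ((r 0).loc a) = chainInit e a := by
  obtain ⟨e, he⟩ := exists_rank (by omega) i
  exact ⟨e, he, hP.exists_run (omission_mem (by rw [card_chainSet e hm (by omega)]; exact hd) _)
    (chainInit e)⟩

theorem chain_run_of (hr : r ∈ γ.runs P) {e : Fin n ≃ Fin n} {m d : ℕ} (hm : m ≤ d) (hd : d ≤ t)
    (ht : t + 2 ≤ n) (henv : (r 0).env = chainPattern e m d)
    (hinit : ∀ a, γ.init a ((r 0).loc a) = chainInit e a) :
    ∀ k ≤ m, (∀ a, γ.decided a ((r k).loc a) = if (e a : ℕ) < k then some 0 else none) ∧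
      (∀ a, k ≤ e a → γ.rd a ((r k).loc a) = if (e a : ℕ) = k ∧ 0 < k then some 0 else none) ∧
      ∀ a v, P a ((r k).loc a) = .decide v ↔ (e a : ℕ) = k ∧ v = 0 :=
  hP.toZeroBiased.chain_run hr hm henv hinit (hP.not_one_zero r hr)
    (fun k hk => hP.not_one_succ r hr k (by omega)) (by omega)

variable (hE : IsEBADecisionProtocol γ P) (hE' : IsEBADecisionProtocol γ P')
  (hdom : Dominates γ P' P)

omit hP in
include hE' in
theorem eq_one_of_init {m : ℕ} (hag : AgreeBefore γ P P' m) (hr : r ∈ γ.runs P)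
    (hinit : ∀ a, γ.init a ((r 0).loc a) = 1) {i : Fin n} (hi : i ∈ (r 0).env.N) {v : Val}
    (h : P' i ((r m).loc i) = .decide v) : v = 1 := by
  obtain ⟨j, hj⟩ := hag.exists_init hE' hr hi h
  rw [← hj, hinit]

include hE hE' hdom

omit hP in
theorem decide_one_of_init {m : ℕ} (hag : AgreeBefore γ P P' m) (hr : r ∈ γ.runs P)
    (hinit : ∀ a, γ.init a ((r 0).loc a) = 1) {i : Fin n} (hi : i ∈ (r 0).env.N) {v : Val}
    (h : P i ((r m).loc i) = .decide v) : P' i ((r m).loc i) = .decide 1 := by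
  obtain ⟨w, hw⟩ := hag.exists_decide hE hE' hdom hr hi h
  obtain ⟨j, hj⟩ := hag.exists_init hE' hr hi hw
  rw [hw, ← hj, hinit]

/-- A protocol that dominates `P` decides `0` where `P` does. -/
theorem decide_zero_of_dominates (ht : t + 2 ≤ n) {m : ℕ} (hag : AgreeBefore γ P P' m)
    (hr : r ∈ γ.runs P) {i : Fin n} (h : P i ((r m).loc i) = .decide 0) :
    P' i ((r m).loc i) = .decide 0 := by
  cases m with
  | zero =>
    have hi0 : γ.init i ((r 0).loc i) = 0 := by
      rcases ((hP.decide_zero_iff _ _).1 h).2 with h | h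
      · exact h
      · rw [rd_zero_time hr] at h; cases h
    -- At time 0 the state depends only on the preference. Without failures and with all preferences
    -- 0, validity leaves only the value 0.
    obtain ⟨r', hr', henv, hinit⟩ := hP.exists_run (α := omission ∅ fun _ _ _ => False)
      (omission_mem (by simp) _) (fun _ => 0)
    have hi : i ∈ (r' 0).env.N := by simp [henv, omission]
    have h' : P i ((r' 0).loc i) = .decide 0 :=
      (hP.decide_zero_iff _ _).2 ⟨decided_zero hr' i, Or.inl (hinit i)⟩
    rw [hP.state_eq r hr r' hr' 0 i (by rw [hi0, hinit]) h h']
    obtain ⟨w, hw⟩ := hag.exists_decide hE hE' hdom hr' hi h'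
    obtain ⟨j, hj⟩ := hag.exists_init hE' hr' hi hw
    rw [hw, ← hj, hinit]
  | succ m =>
    have hmt : m ≤ t := by have := hP.le_of_decide_zero hr h; omega
    -- The nonfaulty agent of rank `m` decides 0 at time `m` and informs `i`, which is then in the
    -- same state as in `r`. Agreement with that agent fixes the value decided by `P'`.
    obtain ⟨e, he, r', hr', henv, hinit⟩ := hP.exists_chain_run i (le_refl m) hmt ht
    obtain ⟨hdec, -, hact⟩ := hP.chain_run_of hr' le_rfl hmt ht henv hinit m le_rfl
    have hej : (e (e.symm ⟨m, by omega⟩) : ℕ) = m := by simp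
    generalize e.symm ⟨m, by omega⟩ = j at hej
    have hi : i ∈ (r' 0).env.N := by rw [henv, chainPattern_N, mem_chainSet]; omega
    have hj : j ∈ (r' 0).env.N := by rw [henv, chainPattern_N, mem_chainSet]; omega
    have hj0 : P j ((r' m).loc j) = .decide 0 := (hact j 0).2 ⟨hej, rfl⟩
    have hid : γ.decided i ((r' (m + 1)).loc i) = none := by
      rw [decided_succ hr', hdec, if_neg (by omega)]
      cases ha : P i ((r' m).loc i) with
      | noop => rfl
      | decide v => have := ((hact i v).1 ha).1; omega
    have h' : P i ((r' (m + 1)).loc i) = .decide 0 :=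
      hP.decided_of_nonfaulty_zero hr' (hP.deliver hr') m.lt_succ_self hj hj0 hid
    rw [hP.state_eq r hr r' hr' (m + 1) i (by
      rw [hP.init_eq_one_of_undecided_succ hr (hP.decided_eq_none_of_decide h),
        hP.init_eq_one_of_undecided_succ hr' hid]) h h']
    obtain ⟨w, hw⟩ := hag.exists_decide hE hE' hdom hr' hi h'
    rw [hw, hag.eq_of_decide hE' hr' hi hj hw (Or.inl (decided_succ_of_decide hr' hj0))]

/-- A protocol that dominates `P` does not decide `1` while an unnoticed chain may exist. -/
theorem not_decide_one_of_chain (ht : t + 2 ≤ n) {m d : ℕ} (hm : m ≤ d) (hd : d ≤ t)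
    (hag : AgreeBefore γ P P' m) (hr : r ∈ γ.runs P) {e : Fin n ≃ Fin n} {i : Fin n}
    (he : (e i : ℕ) = n - 1) (henv : (r 0).env = chainPattern e m d)
    (hinit : ∀ a, γ.init a ((r 0).loc a) = chainInit e a) :
    P' i ((r m).loc i) ≠ .decide 1 := by
  intro h
  have hej : (e (e.symm ⟨m, by omega⟩) : ℕ) = m := by simp
  generalize e.symm ⟨m, by omega⟩ = j at hej
  have hi : i ∈ (r 0).env.N := by rw [henv, chainPattern_N, mem_chainSet]; omega
  have hj : j ∈ (r 0).env.N := by rw [henv, chainPattern_N, mem_chainSet]; omega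
  -- At time `m` itself `P'` is not yet known to act like `P`, so the decision of `j` on 0 has to be
  -- transferred to `P'`.
  have hj0 := hP.decide_zero_of_dominates hE hE' hdom ht hag hr
    (((hP.chain_run_of hr hm hd ht henv hinit m le_rfl).2.2 j 0).2 ⟨hej, rfl⟩)
  exact absurd (hag.eq_of_decide hE' hr hi hj h (Or.inr hj0)) (by decide)

end ZeroChainProtocol

end Chains

/-! ### The minimal context -/

section Min

variable {t : ℕ} {r : Run (minContext n t).E}

theorem Pmin_zeroBiased (n t : ℕ) : ZeroBiased (minContext n t) (Pmin n t) where
  noop_of_decided := fun _ _ h => if_pos h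
  decide_zero_iff := by
    rintro i ⟨T, v, d, p⟩
    simp only [Pmin]
    split_ifs <;> simp_all

theorem Pmin_eq_decide_one_iff (i : Fin n) (s : MinState) :
    Pmin n t i s = .decide 1 ↔
      s.decided = none ∧ ¬ (s.init = 0 ∨ s.rd = some 0) ∧ s.time = t + 1 := by
  simp only [Pmin]
  split_ifs <;> simp_all

theorem Pmin_eq_decide_one_iff_of_mem (hr : r ∈ (minContext n t).runs (Pmin n t)) (m : ℕ)
    (i : Fin n) : Pmin n t i ((r m).loc i) = .decide 1 ↔
      (minContext n t).decided i ((r m).loc i) = none ∧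
      ¬ ((minContext n t).init i ((r m).loc i) = 0 ∨
        (minContext n t).rd i ((r m).loc i) = some 0) ∧ m = t + 1 := by
  rw [Pmin_eq_decide_one_iff]
  have := time_eq hr m i
  rw [show ((r m).loc i : MinState).time = m from this]

theorem MinState.loc_ext {P Q : ActionProtocol (minContext n t).E}
    {r r' : Run (minContext n t).E} (hr : r ∈ (minContext n t).runs P)
    (hr' : r' ∈ (minContext n t).runs Q) {m : ℕ} {i : Fin n}
    (hi : (minContext n t).init i ((r 0).loc i) = (minContext n t).init i ((r' 0).loc i))
    (hd : (minContext n t).decided i ((r m).loc i) = (minContext n t).decided i ((r' m).loc i))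
    (hp : (minContext n t).rd i ((r m).loc i) = (minContext n t).rd i ((r' m).loc i)) :
    (r m).loc i = (r' m).loc i := by
  have ht := (time_eq hr m i).trans (time_eq hr' m i).symm
  rw [← init_eq hr m, ← init_eq hr' m] at hi
  revert ht hi hd hp
  generalize (r m).loc i = s
  generalize (r' m).loc i = s'
  obtain ⟨T, v, d, p⟩ := s
  obtain ⟨T', v', d', p'⟩ := s'
  rintro rfl rfl rfl rfl
  rfl

theorem Pmin_zeroChainProtocol (n t : ℕ) : ZeroChainProtocol (minContext n t) (Pmin n t) t where
  toZeroBiased := Pmin_zeroBiased n t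
  failures_eq := rfl
  exists_initial := fun v => ⟨fun i => ⟨0, v i, none, none⟩, fun i => ⟨v i, rfl⟩, fun _ => rfl⟩
  not_one_zero := by
    intro r hr i h
    have := ((Pmin_eq_decide_one_iff_of_mem hr 0 i).1 h).2.2
    omega
  not_one_succ := by
    intro r hr k hk i j _ h
    have := ((Pmin_eq_decide_one_iff_of_mem hr (k + 1) i).1 h).2.2
    omega
  state_eq := by
    intro r hr r' hr' m i hi h h'
    have hP := Pmin_zeroBiased n t
    refine MinState.loc_ext hr hr' hi ?_ ?_
    · rw [hP.decided_eq_none_of_decide h, hP.decided_eq_none_of_decide h']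
    · cases m with
      | zero => rw [rd_zero_time hr, rd_zero_time hr']
      | succ m => rw [hP.rd_eq_zero_of_decide_succ hr h, hP.rd_eq_zero_of_decide_succ hr' h']

/-! ### Correctness and optimality of the minimal protocol -/

theorem Pmin_decides (hr : r ∈ (minContext n t).runs (Pmin n t)) {i : Fin n}
    (hd : (minContext n t).decided i ((r (t + 1)).loc i) = none) :
    ∃ v, Pmin n t i ((r (t + 1)).loc i) = .decide v := by
  by_cases h : (minContext n t).init i ((r (t + 1)).loc i) = 0 ∨
      (minContext n t).rd i ((r (t + 1)).loc i) = some 0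
  · exact ⟨0, ((Pmin_zeroBiased n t).decide_zero_iff _ _).2 ⟨hd, h⟩⟩
  · exact ⟨1, (Pmin_eq_decide_one_iff_of_mem hr _ i).2 ⟨hd, h, rfl⟩⟩

theorem Pmin_decided (hr : r ∈ (minContext n t).runs (Pmin n t)) {m : ℕ} (hm : t + 1 < m)
    (i : Fin n) : (minContext n t).decided i ((r m).loc i) ≠ none := by
  by_cases hd : (minContext n t).decided i ((r (t + 1)).loc i) = none
  · obtain ⟨v, hv⟩ := Pmin_decides hr hd
    exact decided_ne_none_of_decide hr hm hv
  · exact decided_mono hr hm.le hd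

theorem Pmin_isEBA (n t : ℕ) : IsEBADecisionProtocol (minContext n t) (Pmin n t) where
  decidesOnce := (Pmin_zeroBiased n t).decidesOnce
  uniqueDecision := (Pmin_zeroBiased n t).uniqueDecision
  validity := (Pmin_zeroBiased n t).validity
  termination := fun r hr m i _ => ⟨max m (t + 2), le_max_left _ _, Pmin_decided hr (by omega) i⟩
  agreement := by
    refine agreement_of_not_conflict fun r hr i hi j hj m m' h0 h1 => ?_
    have hP := Pmin_zeroChainProtocol n t
    obtain ⟨hd, -, rfl⟩ := (Pmin_eq_decide_one_iff_of_mem hr m' j).1 h1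
    -- The decision on 1 is made at time `t + 1`. A nonfaulty decision on 0 by time `t` would have
    -- turned it into one on 0; if `i` decides later, the chain behind it supplies such an agent.
    obtain ⟨a, ha, k, hk, hak⟩ : ∃ a ∈ (r 0).env.N, ∃ k ≤ t,
        Pmin n t a ((r k).loc a) = .decide 0 := by
      rcases le_total m t with hm | hm
      · exact ⟨i, hi, m, hm, h0⟩
      · exact hP.exists_nonfaulty_zero hr hm h0
    have := hP.decided_of_nonfaulty_zero hr (hP.deliver hr) (Nat.lt_succ_of_le hk) ha hak hd
    rw [h1] at this
    cases this

theorem Pmin_isOptimalEBA (ht : t + 2 ≤ n) : IsOptimalEBA (minContext n t) (Pmin n t) := by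
  have hE := Pmin_isEBA n t
  have hP := Pmin_zeroChainProtocol n t
  refine .of_unique hE fun P' hE' hdom m hag r hr i hd => ?_
  by_cases h0 : Pmin n t i ((r m).loc i) = .decide 0
  · rw [h0, hP.decide_zero_of_dominates hE hE' hdom ht hag hr h0]
  have hnot : ¬ ((minContext n t).init i ((r m).loc i) = 0 ∨
      (minContext n t).rd i ((r m).loc i) = some 0) :=
    fun h => h0 ((hP.decide_zero_iff _ _).2 ⟨hd, h⟩)
  have hmt : m ≤ t + 1 := by
    by_contra! hm
    exact Pmin_decided hr hm i hd
  have hi1 : (minContext n t).init i ((r 0).loc i) = 1 := by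
    by_contra h
    exact hnot (Or.inl ((init_eq hr m i).trans (val_eq_zero_of_ne_one h)))
  -- Decisions on 1 are made only at time `t + 1`, hence heard only at time `t + 2`.
  have h1rd : ∀ r' ∈ (minContext n t).runs (Pmin n t), ∀ k ≤ t + 1, ∀ j,
      (minContext n t).rd j ((r' k).loc j) ≠ some 1 := by
    intro r' hr' k hk j h
    cases k with
    | zero => rw [rd_zero_time hr'] at h; cases h
    | succ k =>
      obtain ⟨a, -, ha⟩ := exists_of_rd_succ_eq_one hr' h
      have := ((Pmin_eq_decide_one_iff_of_mem hr' k a).1 ha).2.2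
      omega
  have hrd : (minContext n t).rd i ((r m).loc i) = none := by
    match h : (minContext n t).rd i ((r m).loc i) with
    | none => rfl
    | some 0 => exact absurd (Or.inr h) hnot
    | some 1 => exact absurd h (h1rd r hr m hmt i)
  obtain ⟨r₁, hr₁, henv₁, hinit₁⟩ := hP.exists_run (α := omission ∅ fun _ _ _ => False)
    (omission_mem (by simp) _) (fun _ => 1)
  have hi₁ : i ∈ (r₁ 0).env.N := by simp [henv₁, omission]
  have hz₁ : ∀ k j, Pmin n t j ((r₁ k).loc j) ≠ .decide 0 := fun k =>
    hP.no_zero_of_le hr₁ k.zero_le fun j hj => by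
      have := ((hP.decide_zero_iff _ _).1 hj).2
      rw [rd_zero_time hr₁, hinit₁] at this
      rcases this with h | h <;> cases h
  have hd₁ : (minContext n t).decided i ((r₁ m).loc i) = none := by
    match h : (minContext n t).decided i ((r₁ m).loc i) with
    | none => rfl
    | some v =>
      obtain ⟨k, hk, hv⟩ := exists_decide_of_decided hr₁ h
      match v with
      | 0 => exact absurd hv (hz₁ k i)
      | 1 =>
        have := ((Pmin_eq_decide_one_iff_of_mem hr₁ k i).1 hv).2.2
        omega
  have hrd₁ : (minContext n t).rd i ((r₁ m).loc i) = none := by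
    match h : (minContext n t).rd i ((r₁ m).loc i) with
    | none => rfl
    | some 0 =>
      exact absurd ((hP.decide_zero_iff _ _).2 ⟨hd₁, Or.inr h⟩) (hz₁ m i)
    | some 1 => exact absurd h (h1rd r₁ hr₁ m hmt i)
  have hs₁ : (r m).loc i = (r₁ m).loc i :=
    MinState.loc_ext hr hr₁ (by rw [hi1, hinit₁]) (by rw [hd, hd₁]) (by rw [hrd, hrd₁])
  -- At time `t + 1` the run `r₁`, with all preferences 1, forces 1. Before that, it excludes a
  -- decision on 0, and a chain run with `m` faulty agents excludes a decision on 1.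
  rcases Nat.eq_or_lt_of_le hmt with rfl | hlt
  · have h1 := (Pmin_eq_decide_one_iff_of_mem hr (t + 1) i).2 ⟨hd, hnot, rfl⟩
    rw [h1, hs₁]
    rw [hs₁] at h1
    exact ZeroChainProtocol.decide_one_of_init hE hE' hdom hag hr₁ hinit₁ hi₁ h1
  · have hnoop : ∀ v, Pmin n t i ((r m).loc i) ≠ .decide v := by
      intro v h
      match v with
      | 0 => exact h0 h
      | 1 =>
        have := ((Pmin_eq_decide_one_iff_of_mem hr m i).1 h).2.2
        omega
    obtain ⟨e, he, r₂, hr₂, henv₂, hinit₂⟩ :=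
      hP.exists_chain_run i (le_refl m) (Nat.le_of_lt_succ hlt) ht
    obtain ⟨hdec₂, hrd₂, -⟩ :=
      hP.chain_run_of hr₂ le_rfl (Nat.le_of_lt_succ hlt) ht henv₂ hinit₂ m le_rfl
    have hs₂ : (r m).loc i = (r₂ m).loc i :=
      MinState.loc_ext hr hr₂ (by rw [hi1, hinit₂, chainInit_of_pos (by omega)])
        (by rw [hd, hdec₂, if_neg (by omega)])
        (by rw [hrd, hrd₂ i (by omega), if_neg (by omega)])
    have hnot₂ := hP.not_decide_one_of_chain hE hE' hdom ht le_rfl (Nat.le_of_lt_succ hlt) hag hr₂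
      he henv₂ hinit₂
    cases hact : P' i ((r m).loc i) with
    | decide v =>
      have hv : v = 1 := ZeroChainProtocol.eq_one_of_init hE' hag hr₁ hinit₁ hi₁
        (by rw [← hs₁]; exact hact)
      rw [hs₂, hv] at hact
      exact absurd hact hnot₂
    | noop =>
      cases hp : Pmin n t i ((r m).loc i) with
      | decide v => exact absurd hp (hnoop v)
      | noop => rfl

end Min

/-! ### The basic context -/

section Basic

variable {t : ℕ} {P : ActionProtocol (basicContext n t).E} {r : Run (basicContext n t).E}

/-- The number of messages `(init, 1)` that an agent has counted in the last round. -/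
def BasicState.count (s : BasicState n) : ℕ := s.ones

/-- The agents whose message `(init, 1)` to `i` is delivered in round `m + 1`. -/
def heardInit1 (P : ActionProtocol (basicContext n t).E) (r : Run (basicContext n t).E) (m : ℕ)
    (i : Fin n) : Finset (Fin n) :=
  Finset.univ.filter fun j => delivered P m (r m) j i = some BasicMsg.init1

theorem mem_heardInit1 (hr : r ∈ (basicContext n t).runs P) {m : ℕ} {i j : Fin n} :
    j ∈ heardInit1 P r m i ↔ (r 0).env.F m j i = true ∧
      (∀ v, P j ((r m).loc j) ≠ .decide v) ∧
      (basicContext n t).init j ((r 0).loc j) = 1 ∧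
      (basicContext n t).decided j ((r m).loc j) = none ∧
      (basicContext n t).rd j ((r m).loc j) = none := by
  rw [heardInit1, Finset.mem_filter, delivered, env_eq hr, ← init_eq hr m]
  generalize (r m).loc j = s
  cases P j s with
  | decide v => by_cases hF : (r 0).env.F m j i = true <;> simp [basicSend, hF]
  | noop =>
    by_cases hF : (r 0).env.F m j i = true
    · simp [basicSend, hF]
    · simp [hF]

theorem newRd_eq_none_iff (ρ : Fin n → Option Val) : newRd ρ = none ↔ ∀ j, ρ j = none := by
  unfold newRd
  constructor
  · intro h j
    split_ifs at h with h0 h1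
    match hj : ρ j with
    | none => rfl
    | some 0 => exact absurd ⟨j, hj⟩ h0
    | some 1 => exact absurd ⟨j, hj⟩ h1
  · intro h
    simp [h]

theorem BasicMsg.announced_eq_none (m : Option BasicMsg) :
    BasicMsg.announced m = none ↔ ∀ v, m ≠ some (.val v) := by
  rcases m with _ | (w | _) <;> simp [BasicMsg.announced]

theorem count_succ (hr : r ∈ (basicContext n t).runs P) (m : ℕ) (i : Fin n) :
    BasicState.count ((r (m + 1)).loc i) =
      if (basicContext n t).decided i ((r (m + 1)).loc i) = none ∧
        (basicContext n t).rd i ((r (m + 1)).loc i) = none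
      then (heardInit1 P r m i).card else 0 := by
  rw [loc_succ hr]
  simp only [BasicState.count, basicUpdate, newRd_eq_none_iff, BasicMsg.announced_eq_none,
    not_exists, heardInit1]
  split_ifs <;> rfl

theorem count_zero (hr : r ∈ (basicContext n t).runs P) (i : Fin n) :
    BasicState.count ((r 0).loc i) = 0 := by
  obtain ⟨v, hv⟩ := hr.2.1 i
  rw [hv]
  rfl

theorem BasicState.loc_ext {P Q : ActionProtocol (basicContext n t).E}
    {r r' : Run (basicContext n t).E} (hr : r ∈ (basicContext n t).runs P)
    (hr' : r' ∈ (basicContext n t).runs Q) {m : ℕ} {i : Fin n}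
    (hi : (basicContext n t).init i ((r 0).loc i) = (basicContext n t).init i ((r' 0).loc i))
    (hd : (basicContext n t).decided i ((r m).loc i) =
      (basicContext n t).decided i ((r' m).loc i))
    (hp : (basicContext n t).rd i ((r m).loc i) = (basicContext n t).rd i ((r' m).loc i))
    (hc : BasicState.count ((r m).loc i) = BasicState.count ((r' m).loc i)) :
    (r m).loc i = (r' m).loc i := by
  have ht := (time_eq hr m i).trans (time_eq hr' m i).symm
  rw [← init_eq hr m, ← init_eq hr' m] at hi
  revert ht hi hd hp hc
  generalize (r m).loc i = s
  generalize (r' m).loc i = s'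
  obtain ⟨T, v, d, p, c⟩ := s
  obtain ⟨T', v', d', p', c'⟩ := s'
  rintro rfl rfl rfl hc rfl
  rw [Fin.ext (show (c : ℕ) = c' from hc)]

theorem count_of_rd_ne_none (hr : r ∈ (basicContext n t).runs P) {m : ℕ} {i : Fin n}
    (h : (basicContext n t).rd i ((r m).loc i) ≠ none) :
    BasicState.count ((r m).loc i) = 0 := by
  cases m with
  | zero => exact absurd (rd_zero_time hr i) h
  | succ m => rw [count_succ hr, if_neg fun h' => h h'.2]

/-- Agents that have decided do not send `(init, 1)`. -/
theorem count_add_card_le (hr : r ∈ (basicContext n t).runs P) (m : ℕ) (i : Fin n)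
    {S : Finset (Fin n)}
    (hS : ∀ j ∈ S, (basicContext n t).decided j ((r (m + 1)).loc j) ≠ none) :
    BasicState.count ((r (m + 1)).loc i) + S.card ≤ n := by
  rw [count_succ hr]
  have hdisj : Disjoint (heardInit1 P r m i) S := by
    refine Finset.disjoint_left.2 fun j hj hjS => hS j hjS ?_
    obtain ⟨-, hact, -, hd, -⟩ := (mem_heardInit1 hr).1 hj
    rw [decided_succ hr]
    cases ha : P j ((r m).loc j) with
    | decide v => exact absurd ha (hact v)
    | noop => exact hd
  have h := Finset.card_le_univ (heardInit1 P r m i ∪ S)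
  rw [Finset.card_union_of_disjoint hdisj, Fintype.card_fin] at h
  split_ifs <;> omega

/-! ### Correctness of the basic protocol -/

theorem Pbasic_zeroBiased (n t : ℕ) : ZeroBiased (basicContext n t) (Pbasic n t) where
  noop_of_decided := fun _ _ h => if_pos h
  decide_zero_iff := by
    rintro i ⟨T, v, d, p, c⟩
    simp only [Pbasic]
    split_ifs <;> simp_all

theorem Pbasic_eq_decide_one_iff_of_mem (hr : r ∈ (basicContext n t).runs P) (m : ℕ)
    (i : Fin n) : Pbasic n t i ((r m).loc i) = .decide 1 ↔
      (basicContext n t).decided i ((r m).loc i) = none ∧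
      ¬ ((basicContext n t).init i ((r 0).loc i) = 0 ∨
        (basicContext n t).rd i ((r m).loc i) = some 0) ∧
      (n < BasicState.count ((r m).loc i) + m ∨
        (basicContext n t).rd i ((r m).loc i) = some 1) := by
  have := time_eq hr m i
  rw [← init_eq hr m]
  revert this
  generalize (r m).loc i = s
  rintro rfl
  have hiff : ((BasicState.ones s : ℕ) : ℤ) > (n : ℤ) - (BasicState.time s : ℤ) ↔
      n < BasicState.count s + BasicState.time s := by
    unfold BasicState.count
    omega
  simp only [Pbasic, hiff]
  split_ifs <;> simp_all

theorem Pbasic_not_one_zero (hr : r ∈ (basicContext n t).runs (Pbasic n t)) (i : Fin n) :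
    Pbasic n t i ((r 0).loc i) ≠ .decide 1 := by
  intro h
  rcases ((Pbasic_eq_decide_one_iff_of_mem hr 0 i).1 h).2.2 with h | h
  · rw [count_zero hr] at h; omega
  · rw [rd_zero_time hr] at h; cases h

/-- If an agent decides `1`, then no agent has decided `0` in the preceding round. -/
theorem Pbasic_not_one_succ (hr : r ∈ (basicContext n t).runs (Pbasic n t)) (m : ℕ)
    (i j : Fin n) (h0 : Pbasic n t j ((r m).loc j) = .decide 0) :
    Pbasic n t i ((r (m + 1)).loc i) ≠ .decide 1 := by
  have hP := Pbasic_zeroBiased n t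
  induction m generalizing i j with
  | zero =>
    intro h
    rcases ((Pbasic_eq_decide_one_iff_of_mem hr _ i).1 h).2.2 with h | h
    · have := count_add_card_le hr 0 i (S := {j}) (by
        simpa using decided_ne_none_of_decide hr Nat.zero_lt_one h0)
      rw [Finset.card_singleton] at this
      omega
    · obtain ⟨k, -, hk⟩ := exists_of_rd_succ_eq_one hr h
      exact Pbasic_not_one_zero hr k hk
  | succ m ih =>
    intro h
    rcases ((Pbasic_eq_decide_one_iff_of_mem hr _ i).1 h).2.2 with h | h
    -- By time `m + 2` there are `m + 2` agents decided on 0, which leaves at most `n - (m + 2)`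
    -- messages `(init, 1)`: not enough to decide 1.
    · have hc := hP.card_decided_zero hr h0
      have := count_add_card_le hr (m + 1) i (S := Finset.univ.filter fun j =>
        (basicContext n t).decided j ((r (m + 1 + 1)).loc j) = some 0) (by
          intro j hj
          rw [(Finset.mem_filter.1 hj).2]
          simp)
      omega
    -- The announcer `k` decided 1 one round after `l` decided 0: the same conflict, one round
    -- earlier.
    · obtain ⟨k, -, hk⟩ := exists_of_rd_succ_eq_one hr h
      obtain ⟨l, -, hl⟩ := (rd_succ_eq_zero_iff hr m j).1 (hP.rd_eq_zero_of_decide_succ hr h0)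
      exact ih k l hl hk

/-- A decision on 1 shows that nobody decided 0 in the preceding round, and decisions on 0 cannot
resume after a gap. -/
theorem Pbasic_lt_of_decide (hr : r ∈ (basicContext n t).runs (Pbasic n t)) {m m' : ℕ}
    {i j : Fin n} (h0 : Pbasic n t i ((r m).loc i) = .decide 0)
    (h1 : Pbasic n t j ((r m').loc j) = .decide 1) : m < m' := by
  by_contra! hm
  cases m' with
  | zero => exact Pbasic_not_one_zero hr j h1
  | succ k =>
    refine (Pbasic_zeroBiased n t).no_zero_of_le hr (k.le_succ.trans hm) (fun a ha => ?_) i h0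
    exact Pbasic_not_one_succ hr k j a ha h1

theorem Pbasic_zeroChainProtocol (n t : ℕ) :
    ZeroChainProtocol (basicContext n t) (Pbasic n t) t where
  toZeroBiased := Pbasic_zeroBiased n t
  failures_eq := rfl
  exists_initial := fun v =>
    ⟨fun i => ⟨0, v i, none, none, 0⟩, fun i => ⟨v i, rfl⟩, fun _ => rfl⟩
  not_one_zero := fun r hr i => Pbasic_not_one_zero hr i
  not_one_succ := fun r hr k _ i j => Pbasic_not_one_succ hr k i j
  -- Hearing of a decision resets the count to 0, so the count does not distinguish states in which
  -- 0 is decided.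
  state_eq := by
    intro r hr r' hr' m i hi h h'
    have hP := Pbasic_zeroBiased n t
    have hd : (basicContext n t).decided i ((r m).loc i) =
        (basicContext n t).decided i ((r' m).loc i) := by
      rw [hP.decided_eq_none_of_decide h, hP.decided_eq_none_of_decide h']
    cases m with
    | zero =>
      exact BasicState.loc_ext hr hr' hi hd (by rw [rd_zero_time hr, rd_zero_time hr'])
        (by rw [count_zero hr, count_zero hr'])
    | succ m =>
      have h0 := hP.rd_eq_zero_of_decide_succ hr h
      have h0' := hP.rd_eq_zero_of_decide_succ hr' h'
      exact BasicState.loc_ext hr hr' hi hd (by rw [h0, h0'])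
        (by rw [count_of_rd_ne_none hr (by rw [h0]; simp),
          count_of_rd_ne_none hr' (by rw [h0']; simp)])

theorem Pbasic_decides_of_rd (hr : r ∈ (basicContext n t).runs (Pbasic n t)) {m : ℕ}
    {i : Fin n} (hd : (basicContext n t).decided i ((r m).loc i) = none)
    (hrd : (basicContext n t).rd i ((r m).loc i) ≠ none) :
    ∃ v, Pbasic n t i ((r m).loc i) = .decide v := by
  by_cases h : (basicContext n t).init i ((r m).loc i) = 0 ∨
      (basicContext n t).rd i ((r m).loc i) = some 0
  · exact ⟨0, ((Pbasic_zeroBiased n t).decide_zero_iff _ _).2 ⟨hd, h⟩⟩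
  · refine ⟨1, (Pbasic_eq_decide_one_iff_of_mem hr _ i).2 ⟨hd, by rwa [← init_eq hr m], ?_⟩⟩
    match hv : (basicContext n t).rd i ((r m).loc i) with
    | none => exact absurd hv hrd
    | some 0 => exact absurd (Or.inr hv) h
    | some 1 => exact Or.inr rfl

/-- An undecided agent that has not heard of a decision has counted all nonfaulty agents. -/
theorem le_count_of_undecided (hr : r ∈ (basicContext n t).runs (Pbasic n t)) {m : ℕ}
    {i : Fin n} (hd : (basicContext n t).decided i ((r (m + 1)).loc i) = none)
    (hrd : (basicContext n t).rd i ((r (m + 1)).loc i) = none) :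
    n ≤ BasicState.count ((r (m + 1)).loc i) + t := by
  have hP := Pbasic_zeroChainProtocol n t
  -- A nonfaulty decision at time `k` is heard by `i` at time `k + 1`. For `k = m` this contradicts
  -- `hrd`; for `k < m` it would make `i` decide by time `m`.
  have hact : ∀ j ∈ (r 0).env.N, ∀ k ≤ m, ∀ v, Pbasic n t j ((r k).loc j) ≠ .decide v := by
    intro j hj k hk v hv
    have hne := rd_succ_ne_none hr (hP.deliver hr k i j hj) hv
    rcases Nat.eq_or_lt_of_le hk with rfl | hlt
    · exact hne hrd
    · have hdk : (basicContext n t).decided i ((r (k + 1)).loc i) = none := by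
        by_contra h
        exact decided_mono hr (by omega) h hd
      obtain ⟨w, hw⟩ := Pbasic_decides_of_rd hr hdk hne
      exact decided_ne_none_of_decide hr (by omega) hw hd
  have hdec : ∀ j ∈ (r 0).env.N, ∀ k ≤ m + 1,
      (basicContext n t).decided j ((r k).loc j) = none := by
    intro j hj k hk
    by_contra h
    obtain ⟨v, hv⟩ := Option.ne_none_iff_exists'.1 h
    obtain ⟨l, hl, hlv⟩ := exists_decide_of_decided hr hv
    exact hact j hj l (by omega) v hlv
  have hsub : (r 0).env.N ⊆ heardInit1 (Pbasic n t) r m i := by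
    intro j hj
    refine (mem_heardInit1 hr).2 ⟨hP.deliver hr m i j hj, hact j hj m le_rfl,
      hP.init_eq_one_of_undecided_succ hr (hdec j hj _ le_rfl), hdec j hj m m.le_succ, ?_⟩
    by_contra h
    obtain ⟨w, hw⟩ := Pbasic_decides_of_rd hr (hdec j hj m m.le_succ) h
    exact hact j hj m le_rfl w hw
  have h1 := Finset.card_le_card hsub
  have h2 := (hP.env_mem hr).1
  rw [Finset.card_compl, Fintype.card_fin] at h2
  rw [count_succ hr, if_pos ⟨hd, hrd⟩]
  omega

theorem Pbasic_decided (hr : r ∈ (basicContext n t).runs (Pbasic n t)) {m : ℕ} (hm : t + 1 < m)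
    (i : Fin n) : (basicContext n t).decided i ((r m).loc i) ≠ none := by
  by_cases hd : (basicContext n t).decided i ((r (t + 1)).loc i) = none
  · have hP := Pbasic_zeroBiased n t
    obtain ⟨v, hv⟩ : ∃ v, Pbasic n t i ((r (t + 1)).loc i) = .decide v := by
      by_cases hrd : (basicContext n t).rd i ((r (t + 1)).loc i) = none
      · have hc := le_count_of_undecided hr hd hrd
        refine ⟨1, (Pbasic_eq_decide_one_iff_of_mem hr _ i).2 ⟨hd, ?_, Or.inl (by omega)⟩⟩
        rw [hP.init_eq_one_of_undecided_succ hr hd, hrd]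
        simp
      · exact Pbasic_decides_of_rd hr hd hrd
    exact decided_ne_none_of_decide hr hm hv
  · exact decided_mono hr hm.le hd

theorem Pbasic_isEBA (n t : ℕ) : IsEBADecisionProtocol (basicContext n t) (Pbasic n t) where
  decidesOnce := (Pbasic_zeroBiased n t).decidesOnce
  uniqueDecision := (Pbasic_zeroBiased n t).uniqueDecision
  validity := (Pbasic_zeroBiased n t).validity
  termination := fun r hr m i _ =>
    ⟨max m (t + 2), le_max_left _ _, Pbasic_decided hr (by omega) i⟩
  agreement := by
    refine agreement_of_not_conflict fun r hr i hi j _ m m' h0 h1 => ?_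
    have hP := Pbasic_zeroChainProtocol n t
    have := hP.decided_of_nonfaulty_zero hr (hP.deliver hr) (Pbasic_lt_of_decide hr h0 h1) hi h0
      (hP.decided_eq_none_of_decide h1)
    rw [h1] at this
    cases this

/-! ### Runs of the basic protocol in which all agents prefer `1` -/

/-- No agent has decided or heard of a decision. -/
def Quiet (r : Run (basicContext n t).E) (m : ℕ) : Prop :=
  ∀ a, (basicContext n t).decided a ((r m).loc a) = none ∧
    (basicContext n t).rd a ((r m).loc a) = none

theorem Quiet.not_decide_of_count (hr : r ∈ (basicContext n t).runs (Pbasic n t))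
    (hinit : ∀ a, (basicContext n t).init a ((r 0).loc a) = 1) {m : ℕ} (hq : Quiet r m)
    {a : Fin n} (hc : BasicState.count ((r m).loc a) + m ≤ n) (v : Val) :
    Pbasic n t a ((r m).loc a) ≠ .decide v := by
  intro h
  match v with
  | 0 =>
    have := (((Pbasic_zeroBiased n t).decide_zero_iff _ _).1 h).2
    rw [init_eq hr, hinit, (hq a).2] at this
    rcases this with h | h <;> cases h
  | 1 =>
    rcases ((Pbasic_eq_decide_one_iff_of_mem hr m a).1 h).2.2 with h | h
    · omega
    · rw [(hq a).2] at h; cases h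

theorem Quiet.decide_one_of_count (hr : r ∈ (basicContext n t).runs (Pbasic n t))
    (hinit : ∀ a, (basicContext n t).init a ((r 0).loc a) = 1) {m : ℕ} (hq : Quiet r m)
    {a : Fin n} (hc : n < BasicState.count ((r m).loc a) + m) :
    Pbasic n t a ((r m).loc a) = .decide 1 := by
  refine (Pbasic_eq_decide_one_iff_of_mem hr m a).2 ⟨(hq a).1, ?_, Or.inl hc⟩
  rw [hinit, (hq a).2]
  simp

theorem Quiet.succ (hr : r ∈ (basicContext n t).runs (Pbasic n t))
    (hinit : ∀ a, (basicContext n t).init a ((r 0).loc a) = 1) {m : ℕ} (hq : Quiet r m)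
    (hact : ∀ a v, Pbasic n t a ((r m).loc a) ≠ .decide v) :
    Quiet r (m + 1) ∧ ∀ a, BasicState.count ((r (m + 1)).loc a) =
      (Finset.univ.filter fun b => (r 0).env.F m b a = true).card := by
  have hq' : Quiet r (m + 1) := by
    refine fun a => ⟨?_, rd_succ_eq_none hr fun j _ v => hact j v⟩
    rw [decided_succ hr]
    cases ha : Pbasic n t a ((r m).loc a) with
    | decide v => exact absurd ha (hact a v)
    | noop => exact (hq a).1
  refine ⟨hq', fun a => ?_⟩
  rw [count_succ hr, if_pos (hq' a)]
  congr 1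
  ext b
  rw [mem_heardInit1 hr, Finset.mem_filter]
  exact ⟨fun h => ⟨Finset.mem_univ b, h.1⟩, fun h => ⟨h.2, hact b, hinit b, hq b⟩⟩

/-- If the agents of `A` stay silent in the first `m` rounds, and `A` is large enough, then no
agent decides before time `m + 1`. -/
theorem quiet_of_silent (hr : r ∈ (basicContext n t).runs (Pbasic n t))
    (hinit : ∀ a, (basicContext n t).init a ((r 0).loc a) = 1) {A : Finset (Fin n)} {m : ℕ}
    (hm : m ≤ A.card) (hA : ∀ k < m, ∀ a ∈ A, ∀ b, (r 0).env.F k a b = false) :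
    Quiet r m ∧ ∀ a v, Pbasic n t a ((r m).loc a) ≠ .decide v := by
  suffices h : ∀ k ≤ m, Quiet r k ∧ ∀ a v, Pbasic n t a ((r k).loc a) ≠ .decide v from
    h m le_rfl
  have hAn : A.card ≤ n := (Finset.card_le_univ A).trans_eq (Fintype.card_fin n)
  intro k
  induction k with
  | zero =>
    intro _
    have hq : Quiet r 0 := fun a => ⟨decided_zero hr a, rd_zero_time hr a⟩
    exact ⟨hq, fun a => hq.not_decide_of_count hr hinit (by rw [count_zero hr]; omega)⟩
  | succ k ih =>
    intro hk
    obtain ⟨hq, hact⟩ := ih (by omega)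
    obtain ⟨hq', hc⟩ := hq.succ hr hinit hact
    refine ⟨hq', fun a => hq'.not_decide_of_count hr hinit ?_⟩
    -- With `A` silent, counts are at most `n - A.card`, and `k + 1 ≤ A.card` keeps them within the
    -- threshold `n - (k + 1)`.
    have hsub : (Finset.univ.filter fun b => (r 0).env.F k b a = true) ⊆ Aᶜ := by
      intro b hb
      rw [Finset.mem_compl]
      intro hbA
      have := (Finset.mem_filter.1 hb).2
      rw [hA k (by omega) b hbA a] at this
      cases this
    have := Finset.card_le_card hsub
    rw [Finset.card_compl, Fintype.card_fin] at this
    rw [hc]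
    omega

theorem omission_count (A B : Finset (Fin n)) (hB : B ⊆ A)
    (G : ℕ → Fin n → Fin n → Prop) [∀ k a b, Decidable (G k a b)] (m : ℕ) (i : Fin n)
    (hG : ∀ a ∈ A, G m a i ↔ a ∈ B) :
    (Finset.univ.filter fun b => (omission A G).F m b i = true).card + A.card = n + B.card := by
  have : (Finset.univ.filter fun b => (omission A G).F m b i = true) = (A \ B)ᶜ := by
    ext b
    by_cases hb : b ∈ A
    · simp [omission, hb, hG b hb]
    · simp [omission, hb]
  rw [this, Finset.card_compl, Fintype.card_fin, Finset.card_sdiff_of_subset hB]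
  have h1 := Finset.card_le_card hB
  have h2 := (Finset.card_le_univ A).trans_eq (Fintype.card_fin n)
  omega

/-- At time `m` every nonfaulty agent has rank above `m`, hence is still untouched by the chain and
sends `(init, 1)`. The `d` faulty agents do not reach `i`. -/
theorem Pbasic_chain_count (hr : r ∈ (basicContext n t).runs (Pbasic n t)) {e : Fin n ≃ Fin n}
    {m d : ℕ} (hm : m + 1 ≤ d) (hd : d ≤ t) (ht : t + 2 ≤ n)
    (henv : (r 0).env = chainPattern e (m + 1) d)
    (hinit : ∀ a, (basicContext n t).init a ((r 0).loc a) = chainInit e a) {i : Fin n}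
    (he : (e i : ℕ) = n - 1) : BasicState.count ((r (m + 1)).loc i) + d = n := by
  have hrun := (Pbasic_zeroChainProtocol n t).chain_run_of hr hm hd ht henv hinit
  obtain ⟨hdec, hrd, -⟩ := hrun (m + 1) le_rfl
  obtain ⟨hdec', hrd', hact'⟩ := hrun m m.le_succ
  have : heardInit1 (Pbasic n t) r m i = (chainSet e (m + 1) d)ᶜ := by
    ext b
    rw [mem_heardInit1 hr, henv, chainPattern_F, Finset.mem_compl]
    constructor
    · rintro ⟨h | h, -⟩
      · exact h
      · omega
    · intro h
      have hb : m < (e b : ℕ) := by rw [mem_chainSet] at h; omega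
      refine ⟨Or.inl h, fun v hv => ?_, ?_, ?_, ?_⟩
      · have := ((hact' b v).1 hv).1; omega
      · rw [hinit, chainInit_of_pos (by omega)]
      · rw [hdec', if_neg (by omega)]
      · rw [hrd' b hb.le, if_neg (by omega)]
  rw [count_succ hr, if_pos ⟨by rw [hdec, if_neg (by omega)],
    by rw [hrd i (by omega), if_neg (by omega)]⟩, this, Finset.card_compl, Fintype.card_fin,
    card_chainSet e hm (by omega)]
  omega

/-! ### Forced actions of protocols that dominate the basic protocol -/

variable {P' : ActionProtocol (basicContext n t).E}
  (hE' : IsEBADecisionProtocol (basicContext n t) P')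
  (hdom : Dominates (basicContext n t) P' (Pbasic n t))
include hE' hdom

/-- The state is realized with all preferences 1: one nonfaulty agent `j` passes the threshold a
round before `i` does and announces 1 to it. Validity then forces 1. -/
theorem Pbasic_decide_one_of_rd (ht : t + 2 ≤ n) {m : ℕ}
    (hag : AgreeBefore (basicContext n t) (Pbasic n t) P' m)
    (hr : r ∈ (basicContext n t).runs (Pbasic n t)) {i : Fin n} (hm : m ≤ t + 1)
    (hi1 : (basicContext n t).init i ((r 0).loc i) = 1)
    (hd : (basicContext n t).decided i ((r m).loc i) = none)
    (hrd : (basicContext n t).rd i ((r m).loc i) = some 1) :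
    P' i ((r m).loc i) = .decide 1 := by
  have hP := Pbasic_zeroChainProtocol n t
  match m with
  | 0 => rw [rd_zero_time hr] at hrd; cases hrd
  | 1 =>
    obtain ⟨k, -, hk⟩ := exists_of_rd_succ_eq_one hr hrd
    exact absurd hk (Pbasic_not_one_zero hr k)
  | m + 2 =>
    obtain ⟨e, he⟩ := exists_rank (by omega) i
    have hej : (e (e.symm ⟨0, by omega⟩) : ℕ) = 0 := by simp
    generalize e.symm ⟨0, by omega⟩ = j at hej
    -- With `m + 1` silent agents, `i` counts `n - (m + 1)` at time `m + 1`, just too few. Only `j`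
    -- hears the faulty agents in the last of these rounds, so it counts `n` and decides.
    have hA := card_chainSet e (m + 1).zero_le (by omega)
    generalize hAdef : chainSet e 0 (m + 1) = A at hA
    have hiA : i ∉ A := by rw [← hAdef, mem_chainSet]; omega
    have hjA : j ∉ A := by rw [← hAdef, mem_chainSet]; omega
    have hij : i ≠ j := by rintro rfl; omega
    obtain ⟨r₁, hr₁, henv, hinit⟩ := hP.exists_run
      (α := omission A fun k _ b => k = m ∧ b = j) (omission_mem (by omega) _) (fun _ => 1)
    obtain ⟨hq, hact⟩ := quiet_of_silent hr₁ hinit (A := A) (m := m) (by omega) (by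
      intro k hk a ha b
      simp only [henv, omission, ha, decide_eq_false_iff_not]
      simp only [not_true, false_or, not_and]
      omega)
    obtain ⟨hq', hc⟩ := hq.succ hr₁ hinit hact
    have hcj := omission_count A A subset_rfl (fun k _ b => k = m ∧ b = j) m j (by simp)
    have hci := omission_count A ∅ (Finset.empty_subset A) (fun k _ b => k = m ∧ b = j) m i
      (by simp [hij])
    rw [← henv, ← hc] at hcj hci
    rw [Finset.card_empty] at hci
    have hj1 := hq'.decide_one_of_count hr₁ hinit (a := j) (by omega)
    have hi0 := hq'.not_decide_of_count hr₁ hinit (a := i) (by omega)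
    have hz : ∀ a, Pbasic n t a ((r₁ (m + 1)).loc a) ≠ .decide 0 := by
      intro a ha
      have := ((hP.decide_zero_iff _ _).1 ha).2
      rw [(hq' a).2, init_eq hr₁, hinit] at this
      rcases this with h | h <;> cases h
    have hrd₁ := rd_succ_eq_one (i := i) hr₁ hz ⟨j, by simp [henv, omission, hjA], hj1⟩
    have hd₁ : (basicContext n t).decided i ((r₁ (m + 1 + 1)).loc i) = none := by
      rw [decided_succ hr₁]
      cases ha : Pbasic n t i ((r₁ (m + 1)).loc i) with
      | decide v => exact absurd ha (hi0 v)
      | noop => exact (hq' i).1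
    have hs : (r (m + 2)).loc i = (r₁ (m + 2)).loc i :=
      BasicState.loc_ext hr hr₁ (by rw [hi1, hinit]) (by rw [hd, hd₁]) (by rw [hrd, hrd₁])
        (by rw [count_of_rd_ne_none hr (by rw [hrd]; simp),
          count_of_rd_ne_none hr₁ (by rw [hrd₁]; simp)])
    rw [hs]
    obtain ⟨v, hv⟩ := Pbasic_decides_of_rd hr₁ hd₁ (by rw [hrd₁]; simp)
    exact ZeroChainProtocol.decide_one_of_init (Pbasic_isEBA n t) hE' hdom hag hr₁ hinit
      (by simp [henv, omission, hiA]) hv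

/-- The same count is realized with all preferences 1, where validity forces 1. -/
theorem Pbasic_decide_one_of_count (ht : t + 2 ≤ n) {m : ℕ}
    (hag : AgreeBefore (basicContext n t) (Pbasic n t) P' m)
    (hr : r ∈ (basicContext n t).runs (Pbasic n t)) {i : Fin n} (hm : m ≤ t + 1)
    (hi1 : (basicContext n t).init i ((r 0).loc i) = 1)
    (hd : (basicContext n t).decided i ((r m).loc i) = none)
    (hrd : (basicContext n t).rd i ((r m).loc i) = none)
    (hc : n < BasicState.count ((r m).loc i) + m) :
    P' i ((r m).loc i) = .decide 1 := by
  have hP := Pbasic_zeroChainProtocol n t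
  cases m with
  | zero => rw [count_zero hr] at hc; omega
  | succ m =>
    have hcn := count_add_card_le hr m i (S := ∅) (by simp)
    rw [Finset.card_empty] at hcn
    obtain ⟨e, he⟩ := exists_rank (by omega) i
    have hA := card_chainSet e m.zero_le (by omega)
    generalize hAdef : chainSet e 0 m = A at hA
    have hiA : i ∉ A := by rw [← hAdef, mem_chainSet]; omega
    -- The `m` agents of `A` delay all decisions until time `m + 1`. Letting those of `B` through in
    -- the last round raises the count from `n - m` to the required value.
    obtain ⟨B, hBA, hB⟩ := Finset.exists_subset_card_eq
      (show m + BasicState.count ((r (m + 1)).loc i) - n ≤ A.card by omega)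
    obtain ⟨r₁, hr₁, henv, hinit⟩ := hP.exists_run
      (α := omission A fun k a _ => k = m ∧ a ∈ B) (omission_mem (by omega) _) (fun _ => 1)
    obtain ⟨hq, hact⟩ := quiet_of_silent hr₁ hinit (A := A) (m := m) (by omega) (by
      intro k hk a ha b
      simp only [henv, omission, ha, decide_eq_false_iff_not]
      simp only [not_true, false_or, not_and]
      omega)
    obtain ⟨hq', hc'⟩ := hq.succ hr₁ hinit hact
    have hci := omission_count A B hBA (fun k a _ => k = m ∧ a ∈ B) m i (by simp)
    rw [← henv, ← hc'] at hci
    have hs : (r (m + 1)).loc i = (r₁ (m + 1)).loc i :=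
      BasicState.loc_ext hr hr₁ (by rw [hi1, hinit]) (by rw [hd, (hq' i).1])
        (by rw [hrd, (hq' i).2]) (by omega)
    rw [hs] at hc ⊢
    exact ZeroChainProtocol.decide_one_of_init (Pbasic_isEBA n t) hE' hdom hag hr₁ hinit
      (by simp [henv, omission, hiA]) (hq'.decide_one_of_count hr₁ hinit hc)

/-- A low count is compatible both with an unnoticed chain (run `r₂`), which forbids 1, and with
preferences all 1 and silent faulty agents (run `r₁`), which forbid 0. -/
theorem Pbasic_noop_of_count (ht : t + 2 ≤ n) {m : ℕ}
    (hag : AgreeBefore (basicContext n t) (Pbasic n t) P' m)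
    (hr : r ∈ (basicContext n t).runs (Pbasic n t)) {i : Fin n}
    (hi1 : (basicContext n t).init i ((r 0).loc i) = 1)
    (hd : (basicContext n t).decided i ((r m).loc i) = none)
    (hrd : (basicContext n t).rd i ((r m).loc i) = none)
    (hc : BasicState.count ((r m).loc i) + m ≤ n) :
    P' i ((r m).loc i) = .noop := by
  have hP := Pbasic_zeroChainProtocol n t
  -- The number of faulty agents must be `n` minus the count: it is at least `m` by `hc` and at most
  -- `t` by `le_count_of_undecided`. At time 0 the count is 0 by default and carries no information,
  -- so there `d = 0` is taken.
  obtain ⟨d, hmd, hdt, hcd⟩ : ∃ d, m ≤ d ∧ d ≤ t ∧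
      (m ≠ 0 → BasicState.count ((r m).loc i) + d = n) := by
    cases m with
    | zero => exact ⟨0, le_rfl, t.zero_le, fun h => absurd rfl h⟩
    | succ m =>
      have hle := le_count_of_undecided hr hd hrd
      exact ⟨n - BasicState.count ((r (m + 1)).loc i), by omega, by omega, by omega⟩
  obtain ⟨e, he, r₂, hr₂, henv₂, hinit₂⟩ := hP.exists_chain_run i hmd hdt ht
  obtain ⟨hdec₂, hrd₂, -⟩ := hP.chain_run_of hr₂ hmd hdt ht henv₂ hinit₂ m le_rfl
  have hs₂ : (r m).loc i = (r₂ m).loc i := by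
    refine BasicState.loc_ext hr hr₂ (by rw [hi1, hinit₂, chainInit_of_pos (by omega)])
      (by rw [hd, hdec₂, if_neg (by omega)])
      (by rw [hrd, hrd₂ i (by omega), if_neg (by omega)]) ?_
    cases m with
    | zero => rw [count_zero hr, count_zero hr₂]
    | succ m =>
      have := Pbasic_chain_count hr₂ hmd hdt ht henv₂ hinit₂ he
      have := hcd m.succ_ne_zero
      omega
  have hA := card_chainSet e hmd (by omega)
  generalize hAdef : chainSet e m d = A at hA
  have hiA : i ∉ A := by rw [← hAdef, mem_chainSet]; omega
  obtain ⟨r₁, hr₁, henv₁, hinit₁⟩ := hP.exists_run (α := omission A fun _ _ _ => False)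
    (omission_mem (by omega) _) (fun _ => 1)
  have hsilent : ∀ k, ∀ a ∈ A, ∀ b, (r₁ 0).env.F k a b = false := by
    intro k a ha b
    simp [henv₁, omission, ha]
  have hs₁ : (r m).loc i = (r₁ m).loc i := by
    obtain ⟨hq, -⟩ := quiet_of_silent hr₁ hinit₁ (A := A) (m := m) (by omega)
      fun k _ => hsilent k
    refine BasicState.loc_ext hr hr₁ (by rw [hi1, hinit₁]) (by rw [hd, (hq i).1])
      (by rw [hrd, (hq i).2]) ?_
    cases m with
    | zero => rw [count_zero hr, count_zero hr₁]
    | succ m =>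
      obtain ⟨hq', hact'⟩ := quiet_of_silent hr₁ hinit₁ (A := A) (m := m) (by omega)
        fun k _ => hsilent k
      have hcount := (hq'.succ hr₁ hinit₁ hact').2 i
      have hci := omission_count A ∅ (Finset.empty_subset A) (fun _ _ _ => False) m i (by simp)
      rw [← henv₁, ← hcount, Finset.card_empty] at hci
      have := hcd m.succ_ne_zero
      omega
  cases hact : P' i ((r m).loc i) with
  | noop => rfl
  | decide v =>
    have hv : v = 1 := ZeroChainProtocol.eq_one_of_init hE' hag hr₁ hinit₁
      (i := i) (by simp [henv₁, omission, hiA]) (by rw [← hs₁]; exact hact)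
    rw [hs₂, hv] at hact
    exact absurd hact (hP.not_decide_one_of_chain (Pbasic_isEBA n t) hE' hdom ht hmd hdt hag hr₂
      he henv₂ hinit₂)

omit hE' hdom in
theorem Pbasic_isOptimalEBA (ht : t + 2 ≤ n) : IsOptimalEBA (basicContext n t) (Pbasic n t) := by
  have hE := Pbasic_isEBA n t
  have hP := Pbasic_zeroChainProtocol n t
  refine .of_unique hE fun P' hE' hdom m hag r hr i hd => ?_
  by_cases h0 : Pbasic n t i ((r m).loc i) = .decide 0
  · rw [h0, hP.decide_zero_of_dominates hE hE' hdom ht hag hr h0]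
  have hnot : ¬ ((basicContext n t).init i ((r 0).loc i) = 0 ∨
      (basicContext n t).rd i ((r m).loc i) = some 0) := by
    rw [← init_eq hr m]
    exact fun h => h0 ((hP.decide_zero_iff _ _).2 ⟨hd, h⟩)
  have hmt : m ≤ t + 1 := by
    by_contra! hm
    exact Pbasic_decided hr hm i hd
  have hi1 : (basicContext n t).init i ((r 0).loc i) = 1 := by
    by_contra h
    exact hnot (Or.inl (val_eq_zero_of_ne_one h))
  match hrd : (basicContext n t).rd i ((r m).loc i) with
  | some 0 => exact absurd (Or.inr hrd) hnot
  | some 1 =>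
    rw [Pbasic_decide_one_of_rd hE' hdom ht hag hr hmt hi1 hd hrd,
      (Pbasic_eq_decide_one_iff_of_mem hr m i).2 ⟨hd, hnot, Or.inr hrd⟩]
  | none =>
    by_cases hc : n < BasicState.count ((r m).loc i) + m
    · rw [Pbasic_decide_one_of_count hE' hdom ht hag hr hmt hi1 hd hrd hc,
        (Pbasic_eq_decide_one_iff_of_mem hr m i).2 ⟨hd, hnot, Or.inl hc⟩]
    · rw [Pbasic_noop_of_count hE' hdom ht hag hr hi1 hd hrd (by omega)]
      cases hp : Pbasic n t i ((r m).loc i) with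
      | noop => rfl
      | decide v =>
        match v with
        | 0 => exact absurd hp h0
        | 1 =>
          rcases ((Pbasic_eq_decide_one_iff_of_mem hr m i).1 hp).2.2 with h | h
          · exact absurd h hc
          · rw [hrd] at h; cases h

end Basic

end EBA

theorem mainTheorem6 (n t : ℕ) (ht : t + 2 ≤ n) :
    EBA.IsOptimalEBA (EBA.basicContext n t) (EBA.Pbasic n t) ∧
      EBA.IsOptimalEBA (EBA.minContext n t) (EBA.Pmin n t) :=
  ⟨EBA.Pbasic_isOptimalEBA ht, EBA.Pmin_isOptimalEBA ht⟩
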